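/- Let $d\ge 1$, let $\Omega\subset\mathbb R^d$ be a bounded domain with smooth boundary and $0\in\overline\Omega$, let $T>0$, $Q=\Omega\times(0,T)$, and let $H\in C^1([0,T];\mathbb R^d)$ with $H_0:=\min_{t\in[0,T]}|H(t)|>0$. Fix $S_*\in(1/\sqrt2,1)$ and $r>0$. Let $0=t_0<t_1<\dots<t_m=T$ be a partition of $[0,T]$ and put $\eta_j=H(t_j)/|H(t_j)|$ for $0\le j\le m-1$; suppose that $$\frac{H(t)}{|H(t)|}\cdot\eta_j\ge S_*\qquad\text{for all } t\in[t_j,t_{j+1}],\ 0\le j\le m-1.$$ With $\delta_\Omega=\operatorname{diam}\Omega$, $R_0=\frac{1+S_*}{1-S_*}\,\delta_\Omega$, $R_j=2^jR_0+(2^j-1)(\delta_\Omega+r)$, let $x_j=-R_j\eta_j$, $M_\Omega(x_j)=\max_{x\in\overline\Omega}|x-x_j|$ and $d_\Omega(x_j)=\min_{x\in\overline\Omega}|x-x_j|$, and suppose that $$\max_{0\le j\le m-1}\frac{(t_{j+1}-t_j)\,d_\Omega(x_j)}{M_\Omega(x_j)^2}>\frac1{H_0(2S_*^2-1)}.$$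 Then there exists a constant $C>0$ such that for every $g\in L^2(\partial\Omega\times(0,T))$ and every $u\in H^1(Q)$ satisfying $$\partial_tu+H(t)\cdot\nabla u=0\ \text{ in } Q,\qquad u|_{\partial\Omega\times(0,T)}=g$$ (weak derivatives, boundary values in the sense of traces), one has $$\|u(\cdot,t)\|_{L^2(\Omega)}\le C\,\|g\|_{L^2(\partial\Omega\times(0,T))}\qquad\text{for all } t\in[0,T],$$ where $t\mapsto u(\cdot,t)$ denotes the representative of $u$ in $C([0,T];L^2(\Omega))$. -/

import Mathlib

open MeasureTheory Set Filter Topology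
open scoped ENNReal ContDiff Gradient InnerProductSpace

noncomputable section

namespace TransportObs

/-- `ℝᵈ` with its Euclidean norm. -/
abbrev Space (d : ℕ) : Type := EuclideanSpace ℝ (Fin d)

/-- Bounded domain with smooth boundary: a bounded, connected, nonempty open set which, near each
of its boundary points, is the sublevel set `{ρ < 0}` of a smooth function `ρ` whose differential
does not vanish at that point. -/
structure IsSmoothBoundedDomain {d : ℕ} (Ω : Set (Space d)) : Prop where
  isOpen : IsOpen Ω
  isConnected : IsConnected Ω
  isBounded : Bornology.IsBounded Ω
  smooth_boundary : ∀ x₀ ∈ frontier Ω, ∃ V : Set (Space d), ∃ ρ : Space d → ℝ,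
    IsOpen V ∧ x₀ ∈ V ∧ ContDiffOn ℝ ∞ ρ V ∧ fderiv ℝ ρ x₀ ≠ 0 ∧
      Ω ∩ V = {x ∈ V | ρ x < 0}

/-- The cylinder `Q = Ω × (0,T)`. -/
def cylinder {d : ℕ} (Ω : Set (Space d)) (T : ℝ) : Set (Space d × ℝ) := Ω ×ˢ Ioo 0 T

/-- The product measure `dγ dt` on the lateral boundary `∂Ω × (0,T)`, where `dγ` is the
`(d-1)`-dimensional surface measure on `∂Ω`, i.e. the (normalized) Hausdorff measure. It is
a measure on `ℝᵈ × ℝ` concentrated on `∂Ω × (0,T)`. -/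
def lateralMeasure {d : ℕ} (Ω : Set (Space d)) (T : ℝ) : Measure (Space d × ℝ) :=
  ((Measure.euclideanHausdorffMeasure (d - 1)).restrict (frontier Ω)).prod
    (volume.restrict (Ioo 0 T))

/-- Classical gradient in the space variable. -/
def spaceGrad {d : ℕ} (φ : Space d × ℝ → ℝ) (z : Space d × ℝ) : Space d :=
  ∇ (fun x => φ (x, z.2)) z.1

/-- Classical derivative in the time variable. -/
def timeDeriv {d : ℕ} (φ : Space d × ℝ → ℝ) (z : Space d × ℝ) : ℝ :=
  deriv (fun t => φ (z.1, t)) z.2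

/-- An element of the Sobolev space `H¹(Q)`: a function in `L²(Q)` together with its weak
gradient in space and its weak time derivative (which are a.e. unique), both in `L²(Q)`. -/
structure SobolevH1 {d : ℕ} (Q : Set (Space d × ℝ)) where
  /-- the function -/
  val : Space d × ℝ → ℝ
  /-- its weak gradient in `x` -/
  grad : Space d × ℝ → Space d
  /-- its weak derivative in `t` -/
  dt : Space d × ℝ → ℝ
  memLp_val : MemLp val 2 (volume.restrict Q)
  memLp_grad : MemLp grad 2 (volume.restrict Q)
  memLp_dt : MemLp dt 2 (volume.restrict Q)
  weak_grad : ∀ φ : Space d × ℝ → ℝ, ContDiff ℝ ∞ φ → HasCompactSupport φ → tsupport φ ⊆ Q →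
    ∫ z in Q, val z • spaceGrad φ z = - ∫ z in Q, φ z • grad z
  weak_dt : ∀ φ : Space d × ℝ → ℝ, ContDiff ℝ ∞ φ → HasCompactSupport φ → tsupport φ ⊆ Q →
    ∫ z in Q, val z * timeDeriv φ z = - ∫ z in Q, φ z * dt z

/-- Convergence in `H¹(Q)` of a sequence of smooth functions on `ℝᵈ × ℝ` to `u`. -/
def TendstoH1 {d : ℕ} {Q : Set (Space d × ℝ)} (φ : ℕ → Space d × ℝ → ℝ) (u : SobolevH1 Q) :
    Prop :=
  Tendsto (fun n => eLpNorm (fun z => φ n z - u.val z) 2 (volume.restrict Q)) atTop (𝓝 0) ∧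
  Tendsto (fun n => eLpNorm (fun z => spaceGrad (φ n) z - u.grad z) 2 (volume.restrict Q))
    atTop (𝓝 0) ∧
  Tendsto (fun n => eLpNorm (fun z => timeDeriv (φ n) z - u.dt z) 2 (volume.restrict Q))
    atTop (𝓝 0)

/-- `u|_{∂Ω × (0,T)} = g` in the sense of traces. The trace operator is the continuous extension
to `H¹(Q)` of the restriction `φ ↦ φ|_{∂Ω × (0,T)}` of functions `φ` smooth up to the boundary,
so `g` is the trace of `u` when, for some smooth functions `φₙ → u` in `H¹(Q)`, the restrictions
of the `φₙ` to `∂Ω × (0,T)` converge to `g` in `L²`. -/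
def HasLateralTrace {d : ℕ} {Ω : Set (Space d)} {T : ℝ} (u : SobolevH1 (cylinder Ω T))
    (g : Lp ℝ 2 (lateralMeasure Ω T)) : Prop :=
  ∃ φ : ℕ → Space d × ℝ → ℝ, (∀ n, ContDiff ℝ ∞ (φ n)) ∧ TendstoH1 φ u ∧
    Tendsto (fun n => eLpNorm (fun z => φ n z - g z) 2 (lateralMeasure Ω T)) atTop (𝓝 0)

/-- `∂ₜu + H(t) · ∇u = 0` in `Ω × (0,T)` (almost everywhere, the derivatives being the weak
ones, which are `L²` functions). -/
def SolvesTransport {d : ℕ} {Ω : Set (Space d)} {T : ℝ} (H : ℝ → Space d)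
    (u : SobolevH1 (cylinder Ω T)) : Prop :=
  ∀ᵐ z ∂volume.restrict (cylinder Ω T), u.dt z + ⟪H z.2, u.grad z⟫_ℝ = 0

/-- `U` is the representative of `u` in `C([0,T]; L²(Ω))`, that is `U t = u(·,t)`. Any two such
`U` agree on `[0,T]`. -/
def IsTimeSlices {d : ℕ} {Ω : Set (Space d)} {T : ℝ} (u : SobolevH1 (cylinder Ω T))
    (U : ℝ → Lp ℝ 2 (volume.restrict Ω)) : Prop :=
  ContinuousOn U (Icc 0 T) ∧
    ∀ᵐ t ∂volume.restrict (Ioo 0 T), U t =ᵐ[volume.restrict Ω] fun x => u.val (x, t)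

/-- `H₀ = min_{[0,T]} |H|`. -/
def minSpeed {d : ℕ} (H : ℝ → Space d) (T : ℝ) : ℝ := sInf ((fun t => ‖H t‖) '' Icc 0 T)

/-- `0 = t₀ < t₁ < ⋯ < t_m = T`; the values `t j` with `j > m` are irrelevant. -/
structure IsPartition (T : ℝ) (m : ℕ) (t : ℕ → ℝ) : Prop where
  zero : t 0 = 0
  last : t m = T
  lt_succ : ∀ j < m, t j < t (j + 1)

/-- The unit vector `η_j = H(t_j) / |H(t_j)|`. -/
def eta {d : ℕ} (H : ℝ → Space d) (t : ℕ → ℝ) (j : ℕ) : Space d := ‖H (t j)‖⁻¹ • H (t j)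

/-- The angle condition: `H(s)/|H(s)| · η_j ≥ S` for `s ∈ [t_j, t_{j+1}]`, `0 ≤ j ≤ m - 1`. -/
def AngleCondition {d : ℕ} (H : ℝ → Space d) (S : ℝ) (m : ℕ) (t : ℕ → ℝ) : Prop :=
  ∀ j < m, ∀ s ∈ Icc (t j) (t (j + 1)), S ≤ ⟪‖H s‖⁻¹ • H s, eta H t j⟫_ℝ

/-- `R_j = 2^j R₀ + (2^j - 1)(δ + r)` with `R₀ = (1 + S)/(1 - S) δ`, `δ = diam Ω`. -/
def radius {d : ℕ} (Ω : Set (Space d)) (S r : ℝ) (j : ℕ) : ℝ :=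
  2 ^ j * ((1 + S) / (1 - S) * Metric.diam Ω) + (2 ^ j - 1) * (Metric.diam Ω + r)

/-- The points `x_j = - R_j η_j`. -/
def point {d : ℕ} (Ω : Set (Space d)) (H : ℝ → Space d) (S r : ℝ) (t : ℕ → ℝ) (j : ℕ) :
    Space d := -(radius Ω S r j • eta H t j)

/-- `M_Ω(y) = max_{x ∈ closure Ω} |x - y|`. -/
def maxDist {d : ℕ} (Ω : Set (Space d)) (y : Space d) : ℝ :=
  sSup ((fun x => ‖x - y‖) '' closure Ω)

/-- `d_Ω(y) = min_{x ∈ closure Ω} |x - y|`. -/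
def minDist {d : ℕ} (Ω : Set (Space d)) (y : Space d) : ℝ :=
  sInf ((fun x => ‖x - y‖) '' closure Ω)

end TransportObs

end

open TransportObs

/-! Write E(t) = ∫_Ω u(·,t)². Since H does not depend on x, E changes in time only through the flux
across ∂Ω, and the weighted energy ∫_Ω u²⟪η,x⟫ changes at the rate ∫_Ω u²⟪H,η⟫, again up to boundary
flux. If ⟪H,η⟫ ≥ σ on [a,b], the weighted energy must grow by about σ(b-a)E, yet with δ = diam Ω and
0 in the closure it stays between -δE and δE. Hence once σ(b-a) > 2δ the boundary values control E
(`energy_le_of_residual`, `exists_observability`). One affine weight and one subinterval suffice: on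
the interval selected by the hypothesis, 2 diam Ω ≤ |x_j| ≤ M < H₀(2S²-1)(t_{j+1}-t_j) ≤
H₀S(t_{j+1}-t_j), so σ = H₀S works with η = η_j.

Only an upper bound for the flux is needed, so the divergence theorem with its normal vector is
replaced by |∫_Ω ∂ᵢf| ≤ 2∫_{∂Ω}|f| (`enorm_setIntegral_fderiv_single_le`). It follows by slicing Ω
along lines: a slice is a union of disjoint intervals whose endpoints lie on ∂Ω, and projection
along the line does not increase Hausdorff measure.

The estimates are proved for the smooth functions that define the trace, with an error given by the
residual ∂ₜφ + H·∇φ, which tends to zero in L²(Q). The slices of these functions converge in L²(Ω),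
uniformly in time, to the continuous representative of u (`exists_isTimeSlices`), so the bound
passes to the limit. -/

/-! ### Integrals of partial derivatives bounded by boundary integrals. -/

/-- The integral of a derivative over a bounded open subset of the line is controlled by the values
of the primitive at the boundary points. -/
theorem enorm_integral_deriv_le_tsum_frontier {O : Set ℝ} (hO : IsOpen O)
    (hb : Bornology.IsBounded O) {f f' : ℝ → ℝ} (hf : ∀ x, HasDerivAt f (f' x) x)
    (hc : Continuous f') :
    ‖∫ x in O, f' x‖ₑ ≤ 2 * ∑' p : frontier O, ‖f p‖ₑ := by
  classical
  obtain ⟨R, hR⟩ := hb.subset_closedBall 0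
  have hOR : ∀ x ∈ O, -R ≤ x ∧ x ≤ R := fun x hx => by
    have := hR hx
    rw [Real.closedBall_eq_Icc] at this
    simpa using this
  have hcl : IsClosed Oᶜ := hO.isClosed_compl
  -- `β p` is the first point outside `O` after `p`. The set `A` below consists of the left
  -- endpoints of the components of `O`, and the components are the intervals `(p, β p)`.
  set β : ℝ → ℝ := fun p => sInf (Oᶜ ∩ Ioi p) with hβ
  have hne : ∀ p, (Oᶜ ∩ Ioi p).Nonempty := fun p => by
    refine ⟨max p R + 1, fun h => ?_, ?_⟩
    · have := (hOR _ h).2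
      have := le_max_right p R
      linarith
    · have := le_max_left p R
      simp only [mem_Ioi]
      linarith
  have hbdd : ∀ p, BddBelow (Oᶜ ∩ Ioi p) := fun p => ⟨p, fun z hz => hz.2.le⟩
  have hβle : ∀ p z, z ∉ O → p < z → β p ≤ z := fun p z hz hpz => csInf_le (hbdd p) ⟨hz, hpz⟩
  have hβmem : ∀ p, p ∉ O → β p ∉ O := fun p _ =>
    (closure_minimal inter_subset_left hcl) (csInf_mem_closure (hne p) (hbdd p))
  set A : Set ℝ := {p | p ∉ O ∧ p < β p} with hA
  have hsub : ∀ p ∈ A, Ioo p (β p) ⊆ O := fun p hp x hx => by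
    by_contra h
    exact absurd (hβle p x h hx.1) (not_le.2 hx.2)
  have hlt : ∀ p ∈ A, ∀ q ∈ A, p < q → β p ≤ q := fun p _ q hq hpq => hβle p q hq.1 hpq
  have hdisj : A.PairwiseDisjoint fun x => Ioo x (β x) := by
    intro p hp q hq hpq
    rw [Function.onFun, Set.disjoint_left]
    intro x hx hx'
    rcases lt_or_gt_of_ne hpq with h | h
    · exact absurd (hlt p hp q hq h) (not_le.2 (hx'.1.trans hx.2))
    · exact absurd (hlt q hq p hp h) (not_le.2 (hx.1.trans hx'.2))
  have hcount : A.Countable := hdisj.countable_of_Ioo fun x hx => hx.2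
  have hfr : ∀ p ∈ A, p ∈ frontier O ∧ β p ∈ frontier O := fun p hp => by
    have hcl' : Icc p (β p) ⊆ closure O := by
      rw [← closure_Ioo hp.2.ne]
      exact closure_mono (hsub p hp)
    rw [frontier, hO.interior_eq]
    exact ⟨⟨hcl' (left_mem_Icc.2 hp.2.le), hp.1⟩,
      ⟨hcl' (right_mem_Icc.2 hp.2.le), hβmem p hp.1⟩⟩
  have hβinj : ∀ p ∈ A, ∀ q ∈ A, β p = β q → p = q := fun p hp q hq h => by
    by_contra hpq
    rcases lt_or_gt_of_ne hpq with h' | h'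
    · exact absurd (hlt p hp q hq h') (not_le.2 (h ▸ hq.2))
    · exact absurd (hlt q hq p hp h') (not_le.2 (h ▸ hp.2))
  have hUnion : O = ⋃ p : A, Ioo (p : ℝ) (β p) := by
    refine Subset.antisymm (fun x hx => ?_) (iUnion_subset fun p => hsub p p.2)
    have hne' : (Oᶜ ∩ Iic x).Nonempty := ⟨min x (-R) - 1, fun h => by
      have := (hOR _ h).1
      have := min_le_right x (-R)
      linarith, by
      have := min_le_left x (-R)
      simp only [mem_Iic]
      linarith⟩
    have hba : BddAbove (Oᶜ ∩ Iic x) := ⟨x, fun z hz => hz.2⟩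
    have hmem := (hcl.inter isClosed_Iic).csSup_mem hne' hba
    set p := sSup (Oᶜ ∩ Iic x) with hp
    have hpx : p < x := lt_of_le_of_ne hmem.2 fun h => hmem.1 (h ▸ hx)
    have hxβ : x ≤ β p := le_csInf (hne p) fun z hz => by
      by_contra! h
      exact absurd (le_csSup hba ⟨hz.1, h.le⟩) (not_le.2 hz.2)
    have hxβ' : x < β p := lt_of_le_of_ne hxβ fun h => hβmem p hmem.1 (h ▸ hx)
    exact mem_iUnion.2 ⟨⟨p, hmem.1, hpx.trans hxβ'⟩, hpx, hxβ'⟩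
  have hint : IntegrableOn f' O :=
    (hc.continuousOn.integrableOn_compact (isCompact_closedBall (0 : ℝ) R)).mono_set hR
  have : Countable A := hcount.to_subtype
  have hsum : ∫ x in O, f' x = ∑' p : A, (f (β p) - f p) := by
    conv_lhs => rw [hUnion]
    rw [integral_iUnion (s := fun p : A => Ioo (p : ℝ) (β p)) (fun _ => measurableSet_Ioo)
      (fun p q hpq => hdisj p.2 q.2 (fun h => hpq (Subtype.ext h))) (hUnion ▸ hint)]
    refine tsum_congr fun p => ?_
    rw [← integral_Ioc_eq_integral_Ioo, ← intervalIntegral.integral_of_le p.2.2.le]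
    exact intervalIntegral.integral_eq_sub_of_hasDerivAt (fun x _ => hf x)
      (hc.intervalIntegrable _ _)
  -- A boundary point is the left endpoint of at most one component and, `β` being injective on `A`,
  -- the right endpoint of at most one: hence the factor 2.
  calc ‖∫ x in O, f' x‖ₑ ≤ ∑' p : A, ‖f (β p) - f p‖ₑ := hsum ▸ enorm_tsum_le_tsum_enorm
    _ ≤ ∑' p : A, (‖f (β p)‖ₑ + ‖f p‖ₑ) := ENNReal.tsum_le_tsum fun p => enorm_sub_le
    _ = ∑' p : A, ‖f (β p)‖ₑ + ∑' p : A, ‖f p‖ₑ := ENNReal.tsum_add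
    _ ≤ 2 * ∑' p : frontier O, ‖f p‖ₑ := by
      rw [two_mul]
      refine add_le_add ?_ ?_
      · exact ENNReal.tsum_comp_le_tsum_of_injective
          (f := fun p : A => (⟨β p, (hfr p p.2).2⟩ : frontier O))
          (fun p q h => Subtype.ext (hβinj p p.2 q q.2 (congrArg Subtype.val h)))
          fun p => ‖f p‖ₑ
      · exact ENNReal.tsum_mono_subtype (fun p => ‖f p‖ₑ) fun p hp => (hfr p hp).1

/-- Countable measurable partitions of a separable metric space into pieces of small diameter. -/
theorem exists_measurable_cells (X : Type*) [PseudoMetricSpace X] [SecondCountableTopology X]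
    [MeasurableSpace X] [BorelSpace X] {ε : ℝ} (hε : 0 < ε) :
    ∃ c : X → ℕ, Measurable c ∧ ∀ x y, c x = c y → dist x y < ε := by
  classical
  rcases isEmpty_or_nonempty X with hX | hX
  · exact ⟨fun _ => 0, measurable_const, fun x => hX.elim x⟩
  have hp : ∀ x : X, ∃ k, dist x (TopologicalSpace.denseSeq X k) < ε / 2 := fun x =>
    Metric.denseRange_iff.1 (TopologicalSpace.denseRange_denseSeq X) x _ (half_pos hε)
  refine ⟨fun x => Nat.find (hp x), measurable_find hp fun k => ?_, fun x y h => ?_⟩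
  · exact (isOpen_lt (by fun_prop) continuous_const).measurableSet
  · have h1 := Nat.find_spec (hp x)
    have h2 := Nat.find_spec (hp y)
    have h' : Nat.find (hp x) = Nat.find (hp y) := h
    rw [h'] at h1
    linarith [dist_triangle_right x y (TopologicalSpace.denseSeq X (Nat.find (hp y)))]

/-- If a map does not increase measure, then integrating over the base the sums of a function over
the fibres gives at most the integral of the function. -/
theorem lintegral_tsum_fiber_le {X Y : Type*} [MetricSpace X] [SecondCountableTopology X]
    [MeasurableSpace X] [BorelSpace X] [MeasurableSpace Y] {μ : Measure X} {ν : Measure Y}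
    {π : X → Y} (hπ : ∀ s, ν (π '' s) ≤ μ s) {g : X → ℝ≥0∞} (hg : Continuous g)
    {K : Set X} (hK : MeasurableSet K) :
    ∫⁻ y, ∑' x : {x // x ∈ K ∧ π x = y}, g x ∂ν ≤ ∫⁻ x in K, g x ∂μ := by
  classical
  choose c hcm hc using fun n : ℕ =>
    exists_measurable_cells X (ε := 1 / ((n : ℝ) + 1)) (by positivity)
  -- `F n` is a lower approximation of the fibre sum, counting each cell once with the infimum of
  -- `g` on it. Its integral is bounded cell by cell through `hπ`, and Fatou's lemma passes to the
  -- limit. Images of cells need not be measurable, so they are replaced by measurable hulls of the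
  -- same measure.
  set Q : ℕ → ℕ → Set X := fun n k => K ∩ c n ⁻¹' {k} with hQ
  set w : ℕ → ℕ → ℝ≥0∞ := fun n k => ⨅ x ∈ Q n k, g x with hw
  set Z : ℕ → ℕ → Set Y := fun n k => toMeasurable ν (π '' Q n k) with hZ
  set F : ℕ → Y → ℝ≥0∞ := fun n y => ∑' k, (Z n k).indicator (fun _ => w n k) y with hF
  have hQm : ∀ n k, MeasurableSet (Q n k) := fun n k =>
    hK.inter (hcm n (measurableSet_singleton k))
  have hFm : ∀ n, Measurable (F n) := fun n =>
    Measurable.tsum fun k => measurable_const.indicator (measurableSet_toMeasurable _ _)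
  have hFint : ∀ n, ∫⁻ y, F n y ∂ν ≤ ∫⁻ x in K, g x ∂μ := fun n => by
    have hKU : K = ⋃ k, Q n k := by
      ext x
      simp [hQ]
    calc ∫⁻ y, F n y ∂ν = ∑' k, w n k * ν (π '' Q n k) := by
          rw [lintegral_tsum fun k =>
            (measurable_const.indicator (measurableSet_toMeasurable _ _)).aemeasurable]
          refine tsum_congr fun k => ?_
          rw [lintegral_indicator_const (measurableSet_toMeasurable _ _), measure_toMeasurable]
      _ ≤ ∑' k, ∫⁻ x in Q n k, g x ∂μ := by
          refine ENNReal.tsum_le_tsum fun k => ?_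
          calc w n k * ν (π '' Q n k) ≤ w n k * μ (Q n k) := by gcongr; exact hπ _
            _ = ∫⁻ _ in Q n k, w n k ∂μ := by rw [setLIntegral_const]
            _ ≤ ∫⁻ x in Q n k, g x ∂μ :=
              setLIntegral_mono' (hQm n k) fun x hx => iInf₂_le x hx
      _ = ∫⁻ x in K, g x ∂μ := by
          conv_rhs => rw [hKU]
          rw [lintegral_iUnion (hQm n)]
          intro i j hij
          rw [Function.onFun, Set.disjoint_left]
          rintro x ⟨_, hx⟩ ⟨_, hx'⟩
          exact hij (hx.symm.trans hx')
  have hwt : ∀ x ∈ K, Tendsto (fun n => w n (c n x)) atTop (𝓝 (g x)) := fun x hx => by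
    refine tendsto_order.2 ⟨fun a ha => ?_, fun a ha => Eventually.of_forall fun n => ?_⟩
    · obtain ⟨b, hab, hb⟩ := exists_between ha
      obtain ⟨ε, hε, hball⟩ := Metric.mem_nhds_iff.1 (hg.continuousAt.eventually (lt_mem_nhds hb))
      obtain ⟨N, hN⟩ := exists_nat_one_div_lt hε
      filter_upwards [eventually_ge_atTop N] with n hn
      refine hab.trans_le (le_iInf₂ fun z hz => (hball ?_).le)
      have : dist z x < 1 / ((n : ℝ) + 1) := hc n z x hz.2
      refine (this.trans_le ?_).trans hN
      have : (N : ℝ) ≤ n := by exact_mod_cast hn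
      gcongr
    · exact (iInf₂_le x ⟨hx, rfl⟩).trans_lt ha
  refine le_trans (lintegral_mono fun y => ?_) ((lintegral_liminf_le (u := atTop) hFm).trans ?_)
  · change ∑' x : {x // x ∈ K ∧ π x = y}, g x ≤ liminf (fun n => F n y) atTop
    rw [ENNReal.tsum_eq_iSup_sum]
    refine iSup_le fun s => ?_
    have ht : Tendsto (fun n => ∑ x ∈ s, w n (c n x)) atTop (𝓝 (∑ x ∈ s, g x)) :=
      tendsto_finsetSum _ fun x _ => hwt x x.2.1
    rw [← ht.liminf_eq]
    refine liminf_le_liminf ?_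
    -- Once the mesh is below their mutual distances, finitely many points of a fibre lie in
    -- different cells, so none is lost in `F n y`.
    have hinj : ∀ᶠ n in atTop, ∀ x ∈ s, ∀ z ∈ s, c n x = c n z → x = z := by
      refine (Filter.eventually_all_finset s).2 fun x _ =>
        (Filter.eventually_all_finset s).2 fun z _ => ?_
      by_cases hxz : x = z
      · exact Eventually.of_forall fun n _ => hxz
      have hd : 0 < dist (x : X) z := dist_pos.2 fun h => hxz (Subtype.ext h)
      obtain ⟨N, hN⟩ := exists_nat_one_div_lt hd
      filter_upwards [eventually_ge_atTop N] with n hn h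
      have h1 := hc n x z h
      have : (N : ℝ) ≤ n := by exact_mod_cast hn
      have h2 : 1 / ((n : ℝ) + 1) ≤ 1 / ((N : ℝ) + 1) := by gcongr
      exact absurd (h1.trans_le h2) (not_lt.2 hN.le)
    filter_upwards [hinj] with n hn
    calc ∑ x ∈ s, w n (c n x)
        = ∑ x ∈ s, (Z n (c n x)).indicator (fun _ => w n (c n x)) y := by
          refine Finset.sum_congr rfl fun x _ => ?_
          rw [Set.indicator_of_mem]
          exact subset_toMeasurable _ _ ⟨x, ⟨x.2.1, rfl⟩, x.2.2⟩
      _ = ∑ k ∈ s.image (fun x : {x // x ∈ K ∧ π x = y} => c n x),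
          (Z n k).indicator (fun _ => w n k) y :=
          (Finset.sum_image (f := fun k => (Z n k).indicator (fun _ => w n k) y)
            fun x hx z hz h => hn x hx z hz h).symm
      _ ≤ F n y := ENNReal.sum_le_tsum _
  · exact (liminf_le_liminf (Eventually.of_forall hFint)).trans (by simp)

/-- The point of `ℝⁿ⁺¹` whose `i`-th coordinate is `s` and whose other coordinates are `y`. -/
def insertCoord {n : ℕ} (i : Fin (n + 1)) (y : Fin n → ℝ) (s : ℝ) : TransportObs.Space (n + 1) :=
  WithLp.toLp 2 (i.insertNth s y)

/-- Deleting the `i`-th coordinate of a point of `ℝⁿ⁺¹`. -/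
def removeCoord {n : ℕ} (i : Fin (n + 1)) (x : TransportObs.Space (n + 1)) : Fin n → ℝ :=
  fun j => x (i.succAbove j)

theorem removeCoord_insertCoord {n : ℕ} (i : Fin (n + 1)) (y : Fin n → ℝ) (s : ℝ) :
    removeCoord i (insertCoord i y s) = y := by
  ext j
  simp [removeCoord, insertCoord]

theorem insertCoord_apply_same {n : ℕ} (i : Fin (n + 1)) (y : Fin n → ℝ) (s : ℝ) :
    insertCoord i y s i = s := by
  simp [insertCoord]

theorem insertCoord_eq {n : ℕ} (i : Fin (n + 1)) (y : Fin n → ℝ) (s : ℝ) :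
    insertCoord i y s = insertCoord i y 0 + s • EuclideanSpace.single i (1 : ℝ) := by
  ext j
  refine Fin.succAboveCases i ?_ (fun k => ?_) j
  · simp [insertCoord]
  · simp [insertCoord]

theorem hasDerivAt_insertCoord {n : ℕ} (i : Fin (n + 1)) (y : Fin n → ℝ) (s : ℝ) :
    HasDerivAt (insertCoord i y) (EuclideanSpace.single i (1 : ℝ)) s := by
  rw [show insertCoord i y = fun s => insertCoord i y 0 + s • EuclideanSpace.single i (1 : ℝ) from
    funext (insertCoord_eq i y)]
  simpa using ((hasDerivAt_id s).smul_const (EuclideanSpace.single i (1 : ℝ))).const_add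
    (insertCoord i y 0)

theorem continuous_insertCoord {n : ℕ} (i : Fin (n + 1)) (y : Fin n → ℝ) :
    Continuous (insertCoord i y) :=
  continuous_iff_continuousAt.2 fun s => (hasDerivAt_insertCoord i y s).continuousAt

/-- Dropping a coordinate is 1-Lipschitz for the Euclidean norms, hence does not increase
`n`-dimensional Hausdorff measure, which on `ℝⁿ`, suitably normalized, is Lebesgue measure. -/
theorem volume_image_removeCoord_le {n : ℕ} (i : Fin (n + 1))
    (A : Set (TransportObs.Space (n + 1))) :
    volume (removeCoord i '' A) ≤ Measure.euclideanHausdorffMeasure n A := by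
  set π : TransportObs.Space (n + 1) → TransportObs.Space n :=
    fun x => WithLp.toLp 2 (removeCoord i x) with hπ
  have hlip : LipschitzWith 1 π := LipschitzWith.of_dist_le_mul fun x y => by
    rw [NNReal.coe_one, one_mul, EuclideanSpace.dist_eq, EuclideanSpace.dist_eq,
      Fin.sum_univ_succAbove _ i]
    exact Real.sqrt_le_sqrt (le_add_of_nonneg_left (sq_nonneg _))
  have himg : removeCoord i '' A = WithLp.toLp 2 ⁻¹' (π '' A) := by
    ext y
    constructor
    · rintro ⟨x, hx, rfl⟩
      exact ⟨x, hx, rfl⟩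
    · rintro ⟨x, hx, h⟩
      exact ⟨x, hx, WithLp.toLp_injective 2 h⟩
  have hvol : volume (WithLp.toLp 2 ⁻¹' (π '' A) : Set (Fin n → ℝ)) = volume (π '' A) :=
    (PiLp.volume_preserving_toLp (Fin n)).measure_preimage_equiv
      (f := MeasurableEquiv.toLp 2 (Fin n → ℝ)) _
  rw [himg, hvol, ← EuclideanSpace.euclideanHausdorffMeasure_eq_volume,
    Measure.euclideanHausdorffMeasure_def, Measure.euclideanHausdorffMeasure_def]
  simp only [Measure.smul_apply]
  gcongr
  simpa using hlip.hausdorffMeasure_image_le (Nat.cast_nonneg n) A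

theorem integral_eq_integral_insertCoord {n : ℕ} (i : Fin (n + 1))
    {F : TransportObs.Space (n + 1) → ℝ} (hF : Integrable F) :
    ∫ x, F x = ∫ y : Fin n → ℝ, ∫ s, F (insertCoord i y s) := by
  set e := MeasurableEquiv.piFinSuccAbove (fun _ : Fin (n + 1) => ℝ) i
  have he : MeasurePreserving (fun z : ℝ × (Fin n → ℝ) => insertCoord i z.2 z.1) :=
    (PiLp.volume_preserving_toLp (Fin (n + 1))).comp
      (volume_preserving_piFinSuccAbove (fun _ : Fin (n + 1) => ℝ) i).symm
  have hemb : MeasurableEmbedding (fun z : ℝ × (Fin n → ℝ) => insertCoord i z.2 z.1) :=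
    (MeasurableEquiv.toLp 2 (Fin (n + 1) → ℝ)).measurableEmbedding.comp e.symm.measurableEmbedding
  rw [← he.integral_comp hemb F, Measure.volume_eq_prod, integral_prod_symm]
  exact (he.integrable_comp_emb hemb).2 hF

/-- The integral over a bounded open set of a partial derivative is controlled by the integral of
the function over the boundary, for the `n`-dimensional Hausdorff measure. -/
theorem enorm_setIntegral_fderiv_single_le {n : ℕ} (i : Fin (n + 1))
    {Ω : Set (TransportObs.Space (n + 1))} (hΩ : IsOpen Ω) (hb : Bornology.IsBounded Ω)
    {f : TransportObs.Space (n + 1) → ℝ} (hf : ContDiff ℝ 1 f) :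
    ‖∫ x in Ω, fderiv ℝ f x (EuclideanSpace.single i 1)‖ₑ ≤
      2 * ∫⁻ x in frontier Ω, ‖f x‖ₑ ∂Measure.euclideanHausdorffMeasure n := by
  set D : TransportObs.Space (n + 1) → ℝ :=
    fun x => fderiv ℝ f x (EuclideanSpace.single i 1) with hD
  have hDc : Continuous D := (hf.continuous_fderiv one_ne_zero).clm_apply continuous_const
  have hint : IntegrableOn D Ω :=
    (hDc.continuousOn.integrableOn_compact hb.isCompact_closure).mono_set subset_closure
  have hcont := continuous_insertCoord (n := n) i
  rw [← integral_indicator hΩ.measurableSet,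
    integral_eq_integral_insertCoord i (hint.integrable_indicator hΩ.measurableSet)]
  calc ‖∫ y, ∫ s, Ω.indicator D (insertCoord i y s)‖ₑ
      ≤ ∫⁻ y, ‖∫ s, Ω.indicator D (insertCoord i y s)‖ₑ := enorm_integral_le_lintegral_enorm _
    _ ≤ ∫⁻ y, 2 * ∑' x : {x // x ∈ frontier Ω ∧ removeCoord i x = y}, ‖f x‖ₑ := by
        refine lintegral_mono fun y => ?_
        set O : Set ℝ := insertCoord i y ⁻¹' Ω with hO
        have hOo : IsOpen O := hΩ.preimage (hcont y)
        have hOb : Bornology.IsBounded O := by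
          obtain ⟨R, hR⟩ := hb.subset_closedBall 0
          refine (Metric.isBounded_closedBall (x := (0 : ℝ)) (r := R)).subset fun s hs => ?_
          have h1 : ‖insertCoord i y s‖ ≤ R := by simpa using hR hs
          have h2 := PiLp.norm_apply_le (insertCoord i y s) i
          rw [insertCoord_apply_same] at h2
          simpa using h2.trans h1
        have h1 : ∫ s, Ω.indicator D (insertCoord i y s) = ∫ s in O, D (insertCoord i y s) := by
          rw [← integral_indicator hOo.measurableSet]
          rfl
        simp only [h1]
        refine (enorm_integral_deriv_le_tsum_frontier (f := fun s => f (insertCoord i y s)) hOo hOb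
          (fun s => ?_) (hDc.comp (hcont y))).trans ?_
        · exact (hf.differentiable one_ne_zero _).hasFDerivAt.comp_hasDerivAt s
            (hasDerivAt_insertCoord i y s)
        · gcongr
          -- By continuity the frontier of the slice lies over the frontier of `Ω`; distinct points
          -- of the slice differ in their `i`-th coordinate.
          exact ENNReal.tsum_comp_le_tsum_of_injective
            (f := fun p : frontier O => (⟨insertCoord i y p,
              (hcont y).frontier_preimage_subset Ω p.2,
              removeCoord_insertCoord i y p⟩ :
                {x // x ∈ frontier Ω ∧ removeCoord i x = y}))
            (fun p q h => Subtype.ext (by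
              have := congrArg (fun x => (x : TransportObs.Space (n + 1)) i)
                (congrArg Subtype.val h)
              simpa [insertCoord_apply_same] using this))
            fun x => ‖f x‖ₑ
    _ = 2 * ∫⁻ y, ∑' x : {x // x ∈ frontier Ω ∧ removeCoord i x = y}, ‖f x‖ₑ :=
        lintegral_const_mul' _ _ (by simp)
    _ ≤ _ := by
        gcongr
        exact lintegral_tsum_fiber_le (volume_image_removeCoord_le i) hf.continuous.enorm
          isClosed_frontier.measurableSet

theorem enorm_setIntegral_partialDeriv_le {d : ℕ} (hd : 1 ≤ d) (i : Fin d) {Ω : Set (Space d)}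
    (hΩ : IsOpen Ω) (hb : Bornology.IsBounded Ω) {f : Space d → ℝ} (hf : ContDiff ℝ 1 f) :
    ‖∫ x in Ω, fderiv ℝ f x (EuclideanSpace.single i 1)‖ₑ ≤
      2 * ∫⁻ x in frontier Ω, ‖f x‖ₑ ∂Measure.euclideanHausdorffMeasure (d - 1) := by
  obtain ⟨n, rfl⟩ := Nat.exists_eq_add_of_le' hd
  exact enorm_setIntegral_fderiv_single_le i hΩ hb hf

/-! ### Calculus of smooth functions on space-time. -/

/-- Differentiation under the integral sign over a compact interval. -/
theorem hasFDerivAt_intervalIntegral_of_continuous {E : Type*} [NormedAddCommGroup E]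
    [NormedSpace ℝ E] [ProperSpace E] {F : E → ℝ → ℝ} {F' : E → ℝ → E →L[ℝ] ℝ}
    (hF : ∀ x, Continuous (F x)) (hF' : Continuous (Function.uncurry F'))
    (h : ∀ x t, HasFDerivAt (fun x => F x t) (F' x t) x) (a b : ℝ) (x₀ : E) :
    HasFDerivAt (fun x => ∫ t in a..b, F x t) (∫ t in a..b, F' x₀ t) x₀ := by
  obtain ⟨C, hC⟩ := ((isCompact_closedBall x₀ 1).prod
    (isCompact_uIcc (a := a) (b := b))).exists_bound_of_continuousOn hF'.continuousOn
  have hF'x : Continuous (F' x₀) := hF'.comp (by fun_prop : Continuous fun t => (x₀, t))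
  refine intervalIntegral.hasFDerivAt_integral_of_dominated_of_fderiv_le (bound := fun _ => C)
    (Metric.closedBall_mem_nhds x₀ one_pos)
    (Eventually.of_forall fun x => (hF x).aestronglyMeasurable) ((hF x₀).intervalIntegrable _ _)
    hF'x.aestronglyMeasurable (Eventually.of_forall fun t ht x hx => ?_)
    intervalIntegrable_const (Eventually.of_forall fun t _ x _ => h x t)
  exact hC (x, t) ⟨hx, uIoc_subset_uIcc ht⟩

section Smooth

variable {d : ℕ} {φ : Space d × ℝ → ℝ}

theorem hasFDerivAt_spaceSlice (hφ : ContDiff ℝ ∞ φ) (x : Space d) (t : ℝ) :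
    HasFDerivAt (fun x => φ (x, t)) ((fderiv ℝ φ (x, t)).comp (.inl ℝ (Space d) ℝ)) x :=
  ((hφ.differentiable (by simp)) (x, t)).hasFDerivAt.comp x (hasFDerivAt_prodMk_left x t)

theorem spaceGrad_eq (hφ : ContDiff ℝ ∞ φ) (z : Space d × ℝ) :
    spaceGrad φ z = (InnerProductSpace.toDual ℝ (Space d)).symm
      ((fderiv ℝ φ z).comp (.inl ℝ (Space d) ℝ)) := by
  rw [spaceGrad, gradient, (hasFDerivAt_spaceSlice hφ z.1 z.2).fderiv]

theorem continuous_spaceGrad (hφ : ContDiff ℝ ∞ φ) : Continuous (spaceGrad φ) := by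
  rw [show spaceGrad φ = _ from funext (spaceGrad_eq hφ)]
  exact (LinearIsometryEquiv.continuous _).comp
    ((hφ.continuous_fderiv (by simp)).clm_comp continuous_const)

theorem inner_spaceGrad (hφ : ContDiff ℝ ∞ φ) (z : Space d × ℝ) (v : Space d) :
    ⟪v, spaceGrad φ z⟫_ℝ = fderiv ℝ φ z (v, 0) := by
  rw [spaceGrad_eq hφ, real_inner_comm, InnerProductSpace.toDual_symm_apply]
  simp

theorem hasDerivAt_timeSlice (hφ : ContDiff ℝ ∞ φ) (x : Space d) (t : ℝ) :
    HasDerivAt (fun t => φ (x, t)) (fderiv ℝ φ (x, t) (0, 1)) t :=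
  ((hφ.differentiable (by simp)) (x, t)).hasFDerivAt.comp_hasDerivAt t
    ((hasDerivAt_const t x).prodMk (hasDerivAt_id t))

theorem timeDeriv_eq (hφ : ContDiff ℝ ∞ φ) (z : Space d × ℝ) :
    timeDeriv φ z = fderiv ℝ φ z (0, 1) :=
  (hasDerivAt_timeSlice hφ z.1 z.2).deriv

theorem continuous_timeDeriv (hφ : ContDiff ℝ ∞ φ) : Continuous (timeDeriv φ) := by
  rw [show timeDeriv φ = _ from funext (timeDeriv_eq hφ)]
  exact (hφ.continuous_fderiv (by simp)).clm_apply continuous_const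

end Smooth

/-- A continuous function is integrable over a bounded set. -/
theorem Continuous.integrableOn_of_isBounded {X : Type*} [MetricSpace X] [ProperSpace X]
    [MeasurableSpace X] [OpensMeasurableSpace X] {μ : Measure X} [IsFiniteMeasureOnCompacts μ]
    {f : X → ℝ} (hf : Continuous f) {s : Set X} (hs : Bornology.IsBounded s) :
    IntegrableOn f s μ :=
  (hf.continuousOn.integrableOn_compact hs.isCompact_closure).mono_set subset_closure

theorem integral_cylinder {d : ℕ} {Ω : Set (Space d)} (hb : Bornology.IsBounded Ω) {T : ℝ}
    {f : Space d × ℝ → ℝ} (hf : Continuous f) :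
    ∫ z in TransportObs.cylinder Ω T, f z = ∫ x in Ω, ∫ t in Ioo 0 T, f (x, t) := by
  rw [TransportObs.cylinder, Measure.volume_eq_prod, setIntegral_prod]
  exact hf.integrableOn_of_isBounded (hb.prod (Metric.isBounded_Ioo 0 T))

theorem continuous_intervalIntegral_slice {d : ℕ} {f : Space d × ℝ → ℝ} (hf : Continuous f)
    (a b : ℝ) : Continuous fun x => ∫ t in a..b, f (x, t) :=
  intervalIntegral.continuous_parametric_intervalIntegral_of_continuous' (f := fun x t => f (x, t))
    hf a b

/-! ### The weighted energy identity and estimate. -/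

section Energy

variable {d : ℕ} {Ω : Set (Space d)} {T a b : ℝ} {H : ℝ → Space d} {φ : Space d × ℝ → ℝ}

/-- The residual `∂ₜφ + H · ∇φ`. -/
noncomputable def transportResidual {d : ℕ} (H : ℝ → Space d) (φ : Space d × ℝ → ℝ)
    (z : Space d × ℝ) : ℝ :=
  timeDeriv φ z + ⟪H z.2, spaceGrad φ z⟫_ℝ

theorem continuous_transportResidual (hH : Continuous H) (hφ : ContDiff ℝ ∞ φ) :
    Continuous (transportResidual H φ) :=
  (continuous_timeDeriv hφ).add ((hH.comp continuous_snd).inner (continuous_spaceGrad hφ))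

/-- The `i`-th component of the time-integrated flux `∫ H φ² ψ dt`, with `ψ = c + ⟪η, ·⟫`. -/
noncomputable def fluxComponent {d : ℕ} (H : ℝ → Space d) (φ : Space d × ℝ → ℝ) (c : ℝ)
    (η : Space d) (a b : ℝ) (i : Fin d) (x : Space d) : ℝ :=
  ∫ t in a..b, H t i * (φ (x, t) ^ 2 * (c + ⟪η, x⟫_ℝ))

/-- Integrating in time first leaves a C¹ function of `x` alone, to which the boundary bound on `Ω`
applies. -/
theorem exists_hasFDerivAt_fluxComponent (hH : Continuous H) (hφ : ContDiff ℝ ∞ φ) (c : ℝ)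
    (η : Space d) (a b : ℝ) (i : Fin d) :
    ContDiff ℝ 1 (fluxComponent H φ c η a b i) ∧
      ∀ x, fderiv ℝ (fluxComponent H φ c η a b i) x (EuclideanSpace.single i 1) =
        ∫ t in a..b, H t i * (2 * φ (x, t) * fderiv ℝ φ (x, t) (EuclideanSpace.single i 1, 0) *
          (c + ⟪η, x⟫_ℝ) + φ (x, t) ^ 2 * η i) := by
  set F' : Space d → ℝ → Space d →L[ℝ] ℝ := fun x t =>
    H t i • (φ (x, t) ^ 2 • innerSL ℝ η + (c + ⟪η, x⟫_ℝ) •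
      ((2 * φ (x, t)) • (fderiv ℝ φ (x, t)).comp (.inl ℝ (Space d) ℝ))) with hF'
  have hHi : Continuous fun t => H t i := (EuclideanSpace.proj i).continuous.comp hH
  have hφc := hφ.continuous
  have hD : Continuous (fderiv ℝ φ) := hφ.continuous_fderiv (by simp)
  have hF'c : Continuous (Function.uncurry F') := by
    have h1 : Continuous fun z : Space d × ℝ => (fderiv ℝ φ z).comp (.inl ℝ (Space d) ℝ) :=
      hD.clm_comp continuous_const
    have h2 : Continuous fun z : Space d × ℝ => H z.2 i := hHi.comp continuous_snd
    exact h2.smul (((hφc.pow 2).smul continuous_const).add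
      ((by fun_prop : Continuous fun z : Space d × ℝ => c + ⟪η, z.1⟫_ℝ).smul
        ((continuous_const.mul hφc).smul h1)))
  have hder := hasFDerivAt_intervalIntegral_of_continuous
    (F := fun x t => H t i * (φ (x, t) ^ 2 * (c + ⟪η, x⟫_ℝ))) (F' := F')
    (fun x => hHi.mul (((hφc.comp (by fun_prop)).pow 2).mul continuous_const)) hF'c
    (fun x t => by
      have h1 := hasFDerivAt_spaceSlice hφ x t
      have h2 : HasFDerivAt (fun x : Space d => c + ⟪η, x⟫_ℝ) (innerSL ℝ η) x :=
        (innerSL ℝ η).hasFDerivAt.const_add c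
      have h3 := ((h1.pow 2).mul h2).const_mul (H t i)
      refine h3.congr_fderiv ?_
      ext v
      simp [hF']) a b
  have hxc : Continuous fun x => ∫ t in a..b, F' x t :=
    intervalIntegral.continuous_parametric_intervalIntegral_of_continuous' hF'c a b
  refine ⟨contDiff_one_iff_hasFDerivAt.2 ⟨_, hxc, hder⟩, fun x => ?_⟩
  have h := (hder x).fderiv
  change fderiv ℝ (fluxComponent H φ c η a b i) x = _ at h
  have hF'x : Continuous (F' x) := hF'c.comp (by fun_prop : Continuous fun t => (x, t))
  rw [h, ContinuousLinearMap.intervalIntegral_apply (hF'x.intervalIntegrable _ _)]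
  refine intervalIntegral.integral_congr fun t _ => ?_
  simp [hF', EuclideanSpace.inner_single_right]
  ring

/-- The pointwise (in space) form of the energy identity, integrated over a time interval. -/
theorem sq_mul_weight_sub_eq (hH : Continuous H) (hφ : ContDiff ℝ ∞ φ) (c : ℝ) (η : Space d)
    (a b : ℝ) (x : Space d) :
    φ (x, b) ^ 2 * (c + ⟪η, x⟫_ℝ) - φ (x, a) ^ 2 * (c + ⟪η, x⟫_ℝ) =
      (∫ t in a..b, 2 * (φ (x, t) * transportResidual H φ (x, t)) * (c + ⟪η, x⟫_ℝ)) -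
        (∑ i, fderiv ℝ (fluxComponent H φ c η a b i) x (EuclideanSpace.single i 1)) +
        ∫ t in a..b, φ (x, t) ^ 2 * ⟪H t, η⟫_ℝ := by
  have hx : Continuous fun t : ℝ => (x, t) := by fun_prop
  have hφx := hφ.continuous.comp hx
  have hD : Continuous fun t => fderiv ℝ φ (x, t) :=
    (hφ.continuous_fderiv (by simp)).comp hx
  have hHi : ∀ i, Continuous fun t => H t i := fun i => (EuclideanSpace.proj i).continuous.comp hH
  have hr := (continuous_transportResidual hH hφ).comp hx
  have c1 : Continuous fun t => 2 * (φ (x, t) * transportResidual H φ (x, t)) * (c + ⟪η, x⟫_ℝ) :=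
    (continuous_const.mul (hφx.mul hr)).mul continuous_const
  have c2 : ∀ i, Continuous fun t => H t i * (2 * φ (x, t) *
      fderiv ℝ φ (x, t) (EuclideanSpace.single i 1, 0) * (c + ⟪η, x⟫_ℝ) + φ (x, t) ^ 2 * η i) :=
    fun i => (hHi i).mul ((((continuous_const.mul hφx).mul
      (hD.clm_apply continuous_const)).mul continuous_const).add ((hφx.pow 2).mul continuous_const))
  have c12 : Continuous fun t => 2 * (φ (x, t) * transportResidual H φ (x, t)) * (c + ⟪η, x⟫_ℝ) -
      ∑ i, H t i * (2 * φ (x, t) * fderiv ℝ φ (x, t) (EuclideanSpace.single i 1, 0) *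
        (c + ⟪η, x⟫_ℝ) + φ (x, t) ^ 2 * η i) :=
    c1.sub (continuous_finsetSum _ fun i _ => c2 i)
  have c3 : Continuous fun t => φ (x, t) ^ 2 * ⟪H t, η⟫_ℝ :=
    (hφx.pow 2).mul (hH.inner continuous_const)
  have c4 : Continuous fun t =>
      2 * φ (x, t) * fderiv ℝ φ (x, t) (0, 1) * (c + ⟪η, x⟫_ℝ) :=
    ((continuous_const.mul hφx).mul (hD.clm_apply continuous_const)).mul continuous_const
  have hftc := intervalIntegral.integral_eq_sub_of_hasDerivAt (a := a) (b := b)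
    (f := fun t => φ (x, t) ^ 2 * (c + ⟪η, x⟫_ℝ))
    (fun t _ => by
      simpa using ((hasDerivAt_timeSlice hφ x t).pow 2).mul_const (c + ⟪η, x⟫_ℝ))
    (c4.intervalIntegrable _ _)
  rw [← hftc]
  simp_rw [fun i => (exists_hasFDerivAt_fluxComponent hH hφ c η a b i).2 x]
  rw [← intervalIntegral.integral_finsetSum fun i _ => (c2 i).intervalIntegrable _ _,
    ← intervalIntegral.integral_sub (c1.intervalIntegrable _ _)
      ((continuous_finsetSum _ fun i _ => c2 i).intervalIntegrable _ _),
    ← intervalIntegral.integral_add (c12.intervalIntegrable _ _) (c3.intervalIntegrable _ _)]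
  -- With ψ = c + ⟪η,x⟫ and r the residual, the integrands agree because ∂ₜ(φ²ψ) = 2φrψ - div(Hφ²ψ)
  -- + φ²⟪H,η⟫; no term with div H occurs, as H depends on t only.
  refine intervalIntegral.integral_congr fun t _ => ?_
  have h1 : ⟪H t, spaceGrad φ (x, t)⟫_ℝ =
      ∑ i, H t i * fderiv ℝ φ (x, t) (EuclideanSpace.single i 1, 0) := by
    simp_rw [← inner_spaceGrad hφ, EuclideanSpace.inner_single_left, PiLp.inner_apply]
    simp [mul_comm]
  have h2 : ⟪H t, η⟫_ℝ = ∑ i, H t i * η i := by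
    simp [PiLp.inner_apply, mul_comm]
  have h3 : ∑ i, H t i * (2 * φ (x, t) * fderiv ℝ φ (x, t) (EuclideanSpace.single i 1, 0) *
      (c + ⟪η, x⟫_ℝ) + φ (x, t) ^ 2 * η i) = 2 * φ (x, t) * (c + ⟪η, x⟫_ℝ) *
        (∑ i, H t i * fderiv ℝ φ (x, t) (EuclideanSpace.single i 1, 0)) +
          φ (x, t) ^ 2 * ∑ i, H t i * η i := by
    rw [Finset.mul_sum, Finset.mul_sum, ← Finset.sum_add_distrib]
    exact Finset.sum_congr rfl fun i _ => by ring
  simp only [transportResidual, h1, h2, h3, timeDeriv_eq hφ]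
  ring
end Energy

section Energy

variable {d : ℕ} {Ω : Set (Space d)} {T a b : ℝ} {H : ℝ → Space d} {φ : Space d × ℝ → ℝ}

/-- On the boundary the factor `H t i * (c + ⟪η, x⟫_ℝ)` is at most `h * P`, which leaves the
integral of φ² over the lateral boundary, by Tonelli and enlarging `(a,b)` to `(0,T)`. -/
theorem enorm_setIntegral_fderiv_flux_le (hd : 1 ≤ d) (hΩ : IsOpen Ω)
    (hb : Bornology.IsBounded Ω) (ha0 : 0 ≤ a) (hab : a ≤ b) (hbT : b ≤ T) (hH : Continuous H)
    {h : ℝ} (hHh : ∀ t ∈ Icc 0 T, ‖H t‖ ≤ h) (hφ : ContDiff ℝ ∞ φ) {c P : ℝ} {η : Space d}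
    (hP : ∀ x ∈ closure Ω, |c + ⟪η, x⟫_ℝ| ≤ P) (i : Fin d) :
    ‖∫ x in Ω, fderiv ℝ (fluxComponent H φ c η a b i) x (EuclideanSpace.single i 1)‖ₑ ≤
      2 * (ENNReal.ofReal (h * P) * ∫⁻ z, ‖φ z‖ₑ ^ 2 ∂lateralMeasure Ω T) := by
  have hφm : Measurable fun z => ‖φ z‖ₑ ^ 2 := hφ.continuous.enorm.measurable.pow_const 2
  refine (enorm_setIntegral_partialDeriv_le hd i hΩ hb
    (exists_hasFDerivAt_fluxComponent hH hφ c η a b i).1).trans ?_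
  rw [lateralMeasure, lintegral_prod _ hφm.aemeasurable,
    ← lintegral_const_mul' _ _ ENNReal.ofReal_ne_top]
  gcongr 2 * ?_
  refine setLIntegral_mono' isClosed_frontier.measurableSet fun x hx => ?_
  rw [fluxComponent, intervalIntegral.integral_of_le hab, integral_Ioc_eq_integral_Ioo,
    ← lintegral_const_mul' _ _ ENNReal.ofReal_ne_top]
  refine (enorm_integral_le_lintegral_enorm _).trans ?_
  refine le_trans ?_ (lintegral_mono_set (Ioo_subset_Ioo ha0 hbT))
  refine setLIntegral_mono' measurableSet_Ioo fun t ht => ?_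
  have h0 : (0 : ℝ) ≤ h := (norm_nonneg _).trans (hHh t ⟨ha0.trans ht.1.le, ht.2.le.trans hbT⟩)
  have h1 : ‖H t i * (c + ⟪η, x⟫_ℝ)‖ ≤ h * P := by
    rw [norm_mul]
    exact mul_le_mul ((PiLp.norm_apply_le (H t) i).trans
      (hHh t ⟨ha0.trans ht.1.le, ht.2.le.trans hbT⟩)) (hP x (frontier_subset_closure hx))
      (norm_nonneg _) h0
  calc ‖H t i * (φ (x, t) ^ 2 * (c + ⟪η, x⟫_ℝ))‖ₑ
      = ‖H t i * (c + ⟪η, x⟫_ℝ)‖ₑ * ‖φ (x, t)‖ₑ ^ 2 := by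
        rw [← enorm_pow, ← enorm_mul]
        congr 1
        ring
    _ ≤ _ := by
        gcongr
        rw [← ofReal_norm]
        exact ENNReal.ofReal_le_ofReal h1

/-- Weighted energy estimate for a smooth function, with an affine weight: the change of the
weighted energy between two times is given by the transport of the weight, up to the residual of
the transport equation and to the boundary values. -/
theorem abs_energy_sub_le (hd : 1 ≤ d) (hΩ : IsOpen Ω)
    (hb : Bornology.IsBounded Ω) (ha0 : 0 ≤ a) (hab : a ≤ b) (hbT : b ≤ T) (hH : Continuous H)
    {h : ℝ} (hh : 0 ≤ h) (hHh : ∀ t ∈ Icc 0 T, ‖H t‖ ≤ h) (hφ : ContDiff ℝ ∞ φ) {c P : ℝ}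
    {η : Space d} (hP0 : 0 ≤ P) (hP : ∀ x ∈ closure Ω, |c + ⟪η, x⟫_ℝ| ≤ P) {B : ℝ} (hB0 : 0 ≤ B)
    (hB : ∫⁻ z, ‖φ z‖ₑ ^ 2 ∂lateralMeasure Ω T ≤ ENNReal.ofReal B) :
    |(∫ x in Ω, φ (x, b) ^ 2 * (c + ⟪η, x⟫_ℝ)) - (∫ x in Ω, φ (x, a) ^ 2 * (c + ⟪η, x⟫_ℝ)) -
        ∫ x in Ω, ∫ t in a..b, φ (x, t) ^ 2 * ⟪H t, η⟫_ℝ| ≤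
      2 * P * (∫ z in TransportObs.cylinder Ω T, |φ z * transportResidual H φ z|) +
        d * (2 * (h * P * B)) := by
  have hφc := hφ.continuous
  have hrc := continuous_transportResidual hH hφ
  have hψ : Continuous fun x : Space d => c + ⟪η, x⟫_ℝ := by fun_prop
  have hf := fun i => exists_hasFDerivAt_fluxComponent hH hφ c η a b i
  have hD : ∀ i, Continuous fun x =>
      fderiv ℝ (fluxComponent H φ c η a b i) x (EuclideanSpace.single i 1) := fun i =>
    ((hf i).1.continuous_fderiv one_ne_zero).clm_apply continuous_const
  have cE : ∀ t, Continuous fun x => φ (x, t) ^ 2 * (c + ⟪η, x⟫_ℝ) := fun t =>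
    ((hφc.comp (by fun_prop)).pow 2).mul hψ
  have cEE : Continuous fun x =>
      φ (x, b) ^ 2 * (c + ⟪η, x⟫_ℝ) - φ (x, a) ^ 2 * (c + ⟪η, x⟫_ℝ) := (cE b).sub (cE a)
  have cR' : Continuous fun z : Space d × ℝ =>
      2 * (φ z * transportResidual H φ z) * (c + ⟪η, z.1⟫_ℝ) :=
    (continuous_const.mul (hφc.mul hrc)).mul (hψ.comp continuous_fst)
  have cR : Continuous fun x => ∫ t in a..b,
      2 * (φ (x, t) * transportResidual H φ (x, t)) * (c + ⟪η, x⟫_ℝ) :=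
    continuous_intervalIntegral_slice cR' a b
  have cW : Continuous fun x => ∫ t in a..b, φ (x, t) ^ 2 * ⟪H t, η⟫_ℝ :=
    continuous_intervalIntegral_slice (f := fun z : Space d × ℝ => φ z ^ 2 * ⟪H z.2, η⟫_ℝ)
      ((hφc.pow 2).mul ((hH.comp continuous_snd).inner continuous_const)) a b
  have cA : Continuous fun z : Space d × ℝ => |φ z * transportResidual H φ z| :=
    (hφc.mul hrc).abs
  have hkey : (∫ x in Ω, φ (x, b) ^ 2 * (c + ⟪η, x⟫_ℝ)) -
      (∫ x in Ω, φ (x, a) ^ 2 * (c + ⟪η, x⟫_ℝ)) -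
        (∫ x in Ω, ∫ t in a..b, φ (x, t) ^ 2 * ⟪H t, η⟫_ℝ) =
      (∫ x in Ω, ∫ t in a..b,
        2 * (φ (x, t) * transportResidual H φ (x, t)) * (c + ⟪η, x⟫_ℝ)) -
      ∑ i, ∫ x in Ω, fderiv ℝ (fluxComponent H φ c η a b i) x (EuclideanSpace.single i 1) := by
    rw [← integral_sub ((cE b).integrableOn_of_isBounded hb) ((cE a).integrableOn_of_isBounded hb),
      ← integral_sub (cEE.integrableOn_of_isBounded hb)
        (cW.integrableOn_of_isBounded hb),
      ← integral_finsetSum _ fun i _ => (hD i).integrableOn_of_isBounded hb,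
      ← integral_sub (cR.integrableOn_of_isBounded hb)
        ((continuous_finsetSum _ fun i _ => hD i).integrableOn_of_isBounded hb)]
    refine integral_congr_ae (Eventually.of_forall fun x => ?_)
    have := sq_mul_weight_sub_eq hH hφ c η a b x
    simp only
    linarith
  have hres : |∫ x in Ω, ∫ t in a..b,
      2 * (φ (x, t) * transportResidual H φ (x, t)) * (c + ⟪η, x⟫_ℝ)| ≤
        2 * P * ∫ z in TransportObs.cylinder Ω T, |φ z * transportResidual H φ z| := by
    rw [integral_cylinder hb cA, ← integral_const_mul]
    have cA' : Continuous fun x => 2 * P * ∫ t in (0 : ℝ)..T,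
        |φ (x, t) * transportResidual H φ (x, t)| :=
      continuous_const.mul (continuous_intervalIntegral_slice cA 0 T)
    have h0T : 0 ≤ T := ha0.trans (hab.trans hbT)
    have hI : ∀ x : Space d, ∫ t in Ioo 0 T, |φ (x, t) * transportResidual H φ (x, t)| =
        ∫ t in (0 : ℝ)..T, |φ (x, t) * transportResidual H φ (x, t)| := fun x => by
      rw [intervalIntegral.integral_of_le h0T, integral_Ioc_eq_integral_Ioo]
    simp_rw [hI]
    rw [← Real.norm_eq_abs]
    refine (norm_integral_le_integral_norm _).trans ?_
    refine setIntegral_mono_on (cR.norm.integrableOn_of_isBounded hb)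
      (cA'.integrableOn_of_isBounded hb) hΩ.measurableSet fun x hx => ?_
    have hcx : Continuous fun t : ℝ => |φ (x, t) * transportResidual H φ (x, t)| :=
      cA.comp (by fun_prop)
    calc ‖∫ t in a..b, 2 * (φ (x, t) * transportResidual H φ (x, t)) * (c + ⟪η, x⟫_ℝ)‖
        ≤ ∫ t in a..b, 2 * P * |φ (x, t) * transportResidual H φ (x, t)| := by
          refine intervalIntegral.norm_integral_le_of_norm_le hab
            (Eventually.of_forall fun t _ => ?_) ((continuous_const.mul hcx).intervalIntegrable _ _)
          rw [norm_mul, norm_mul, Real.norm_eq_abs, Real.norm_eq_abs, Real.norm_eq_abs,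
            abs_of_pos (two_pos : (0 : ℝ) < 2), mul_right_comm]
          gcongr
          exact hP x (subset_closure hx)
      _ = 2 * P * ∫ t in a..b, |φ (x, t) * transportResidual H φ (x, t)| :=
          intervalIntegral.integral_const_mul _ _
      _ ≤ _ := by
          gcongr
          exact intervalIntegral.integral_mono_interval ha0 hab hbT
            (Eventually.of_forall fun t => abs_nonneg _) (hcx.intervalIntegrable _ _)
  have hflux : ∀ i, |∫ x in Ω,
      fderiv ℝ (fluxComponent H φ c η a b i) x (EuclideanSpace.single i 1)| ≤
        2 * (h * P * B) := fun i => by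
    have h1 : ‖∫ x in Ω,
        fderiv ℝ (fluxComponent H φ c η a b i) x (EuclideanSpace.single i 1)‖ₑ ≤
          ENNReal.ofReal (2 * (h * P * B)) := by
      refine (enorm_setIntegral_fderiv_flux_le hd hΩ hb ha0 hab hbT hH hHh hφ hP i).trans ?_
      rw [ENNReal.ofReal_mul (p := 2) two_pos.le, ENNReal.ofReal_mul (p := h * P) (by positivity),
        ENNReal.ofReal_ofNat]
      gcongr
    rw [← ofReal_norm] at h1
    exact (ENNReal.ofReal_le_ofReal_iff (by positivity)).1 h1
  rw [hkey]
  refine (abs_sub _ _).trans (add_le_add hres ((Finset.abs_sum_le_sum_abs _ _).trans ?_))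
  refine (Finset.sum_le_sum fun i _ => hflux i).trans_eq ?_
  simp
end Energy

/-! ### L² norms and time slices. -/

theorem lintegral_enorm_sq_eq {α E : Type*} [MeasurableSpace α] [NormedAddCommGroup E]
    (μ : Measure α) (f : α → E) : ∫⁻ x, ‖f x‖ₑ ^ 2 ∂μ = eLpNorm f 2 μ ^ 2 := by
  have := eLpNorm_nnreal_pow_eq_lintegral (μ := μ) (f := f) (p := 2) two_ne_zero
  simpa using this.symm

theorem toReal_eLpNorm_two_sq {α E : Type*} [MeasurableSpace α] [NormedAddCommGroup E]
    {μ : Measure α} {f : α → E} (hf : AEStronglyMeasurable f μ) :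
    (eLpNorm f 2 μ).toReal ^ 2 = ∫ x, ‖f x‖ ^ 2 ∂μ := by
  have hm : AEStronglyMeasurable (fun x => ‖f x‖ ^ 2) μ := hf.norm.pow 2
  rw [← ENNReal.toReal_pow, ← lintegral_enorm_sq_eq,
    integral_eq_lintegral_of_nonneg_ae (Eventually.of_forall fun x => by positivity) hm]
  congr 1
  refine lintegral_congr fun x => ?_
  rw [ENNReal.ofReal_pow (norm_nonneg _), ofReal_norm]

theorem integral_abs_mul_le_eLpNorm_two {α : Type*} [MeasurableSpace α] {μ : Measure α}
    {f g : α → ℝ} (hf : MemLp f 2 μ) (hg : MemLp g 2 μ) :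
    ∫ x, |f x * g x| ∂μ ≤ (eLpNorm f 2 μ).toReal * (eLpNorm g 2 μ).toReal := by
  have h := eLpNorm_smul_le_mul_eLpNorm (p := 2) (q := 2) (r := 1) hg.1 hf.1
  have h1 : ∫ x, |f x * g x| ∂μ = (eLpNorm (f • g) 1 μ).toReal := by
    rw [eLpNorm_one_eq_lintegral_enorm, ← integral_norm_eq_lintegral_enorm (hf.1.smul hg.1)]
    rfl
  rw [h1, ← ENNReal.toReal_mul]
  exact ENNReal.toReal_mono (ENNReal.mul_ne_top hf.2.ne hg.2.ne) h

theorem Continuous.memLp_of_isBounded {X E : Type*} [MetricSpace X] [ProperSpace X]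
    [MeasurableSpace X] [BorelSpace X] {μ : Measure X} [IsFiniteMeasureOnCompacts μ]
    [NormedAddCommGroup E] {f : X → E} (hf : Continuous f) {s : Set X}
    (hs : Bornology.IsBounded s) (p : ℝ≥0∞) : MemLp f p (μ.restrict s) := by
  obtain ⟨C, hC⟩ := hs.isCompact_closure.exists_bound_of_continuousOn hf.continuousOn
  have h : IsFiniteMeasure (μ.restrict (closure s)) :=
    ⟨by simpa using hs.isCompact_closure.measure_lt_top⟩
  refine MemLp.mono_measure (Measure.restrict_mono subset_closure le_rfl) (MemLp.of_bound
    hf.aestronglyMeasurable C ?_)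
  filter_upwards [ae_restrict_mem isClosed_closure.measurableSet] with x hx using hC x hx

/-- Fatou's lemma. It gives smallness at almost every point without extracting a subsequence. -/
theorem ae_liminf_eq_zero_of_tendsto_lintegral {α : Type*} [MeasurableSpace α] {μ : Measure α}
    {f : ℕ → α → ℝ≥0∞} (hf : ∀ n, AEMeasurable (f n) μ)
    (h : Tendsto (fun n => ∫⁻ x, f n x ∂μ) atTop (𝓝 0)) :
    ∀ᵐ x ∂μ, liminf (fun n => f n x) atTop = 0 := by
  have h1 : ∫⁻ x, liminf (fun n => (hf n).mk (f n) x) atTop ∂μ = 0 := by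
    refine le_antisymm ((lintegral_liminf_le fun n => (hf n).measurable_mk).trans ?_) zero_le
    rw [show (fun n => ∫⁻ x, (hf n).mk (f n) x ∂μ) = fun n => ∫⁻ x, f n x ∂μ from
      funext fun n => lintegral_congr_ae (hf n).ae_eq_mk.symm, h.liminf_eq]
  rw [lintegral_eq_zero_iff (.liminf fun n => (hf n).measurable_mk)] at h1
  filter_upwards [h1, ae_all_iff.2 fun n => (hf n).ae_eq_mk] with x hx hx'
  simpa [hx'] using hx

section Slices

variable {d : ℕ} {Ω : Set (Space d)} {T : ℝ}

/-- The time slice of a continuous function, as an element of `L²(Ω)`. -/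
noncomputable def sliceLp (hb : Bornology.IsBounded Ω) {φ : Space d × ℝ → ℝ} (hφ : Continuous φ)
    (t : ℝ) : Lp ℝ 2 (volume.restrict Ω) :=
  ((hφ.comp (by fun_prop : Continuous fun x : Space d => (x, t))).memLp_of_isBounded hb 2).toLp _

theorem norm_sliceLp_sq (hb : Bornology.IsBounded Ω) {φ : Space d × ℝ → ℝ} (hφ : Continuous φ)
    (t : ℝ) : ‖sliceLp hb hφ t‖ ^ 2 = ∫ x in Ω, φ (x, t) ^ 2 := by
  rw [sliceLp, Lp.norm_toLp, toReal_eLpNorm_two_sq]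
  · simp
  · exact (hφ.comp (by fun_prop : Continuous fun x : Space d => (x, t))).aestronglyMeasurable

theorem continuous_sliceLp (hb : Bornology.IsBounded Ω) {φ : Space d × ℝ → ℝ}
    (hφ : Continuous φ) : Continuous (sliceLp hb hφ) := by
  refine continuous_iff_continuousAt.2 fun s => tendsto_iff_norm_sub_tendsto_zero.2 ?_
  have hsub : ∀ t, ‖sliceLp hb hφ t - sliceLp hb hφ s‖ ^ 2 =
      ∫ x in Ω, (φ (x, t) - φ (x, s)) ^ 2 := fun t => by
    rw [sliceLp, sliceLp, ← MemLp.toLp_sub, Lp.norm_toLp, toReal_eLpNorm_two_sq]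
    · simp
    · exact ((hφ.comp (by fun_prop)).sub (hφ.comp (by fun_prop))).aestronglyMeasurable
  -- The domain is enlarged to its compact closure, where continuity in the parameter is available;
  -- the integrand is nonnegative, so this only increases the integral.
  have hc : Continuous fun t => ∫ x in closure Ω, (φ (x, t) - φ (x, s)) ^ 2 :=
    continuous_parametric_integral_of_continuous (f := fun t x => (φ (x, t) - φ (x, s)) ^ 2)
      (((hφ.comp (by fun_prop)).sub (hφ.comp (by fun_prop))).pow 2) hb.isCompact_closure
  have h0 : Tendsto (fun t => ∫ x in closure Ω, (φ (x, t) - φ (x, s)) ^ 2) (𝓝 s) (𝓝 0) := by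
    simpa using hc.tendsto s
  have hsq : Tendsto (fun t => ‖sliceLp hb hφ t - sliceLp hb hφ s‖ ^ 2) (𝓝 s) (𝓝 0) := by
    refine squeeze_zero (fun t => by positivity) (fun t => ?_) h0
    rw [hsub t]
    refine setIntegral_mono_set ?_ (Eventually.of_forall fun x => sq_nonneg _)
      (Eventually.of_forall subset_closure)
    exact Continuous.integrableOn_of_isBounded
      (((hφ.comp (by fun_prop)).sub (hφ.comp (by fun_prop))).pow 2) hb.closure
  have := hsq.sqrt
  simpa using this

theorem continuous_energy (hb : Bornology.IsBounded Ω) {φ : Space d × ℝ → ℝ}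
    (hφ : Continuous φ) : Continuous fun t => ∫ x in Ω, φ (x, t) ^ 2 := by
  simp_rw [← norm_sliceLp_sq hb hφ]
  exact (continuous_sliceLp hb hφ).norm.pow 2

theorem integral_integral_slices_comm (hb : Bornology.IsBounded Ω)
    {f : Space d × ℝ → ℝ} (hf : Continuous f) (a b : ℝ) (hab : a ≤ b) :
    ∫ x in Ω, ∫ t in a..b, f (x, t) = ∫ t in a..b, ∫ x in Ω, f (x, t) := by
  simp_rw [intervalIntegral.integral_of_le hab]
  refine integral_integral_swap ?_
  rw [Measure.prod_restrict]
  exact hf.integrableOn_of_isBounded (hb.prod (Metric.isBounded_Ioc a b))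

/-- The supremum in time of the `L²(Ω)` norm is controlled by the `L²(Q)` norms of the function and
of its time derivative. -/
theorem energy_le_of_timeDeriv (hΩ : IsOpen Ω) (hb : Bornology.IsBounded Ω) (hT : 0 < T)
    {φ : Space d × ℝ → ℝ} (hφ : ContDiff ℝ ∞ φ) {s : ℝ} (hs : s ∈ Icc 0 T) :
    T * ∫ x in Ω, φ (x, s) ^ 2 ≤ (∫ z in TransportObs.cylinder Ω T, φ z ^ 2) +
      T * (2 * ∫ z in TransportObs.cylinder Ω T, |φ z * timeDeriv φ z|) := by
  have hφc := hφ.continuous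
  set ρ := 2 * ∫ z in TransportObs.cylinder Ω T, |φ z * timeDeriv φ z| with hρ
  have cA : Continuous fun z => |φ z * timeDeriv φ z| := (hφc.mul (continuous_timeDeriv hφ)).abs
  -- The energies at any two times are compared through ∂ₜ(φ²) = 2φ∂ₜφ; integrating over the free
  -- time `t` in [0,T] then gives the claim.
  have hdiff : ∀ t ∈ Icc 0 T, ∫ x in Ω, φ (x, s) ^ 2 ≤ (∫ x in Ω, φ (x, t) ^ 2) + ρ := by
    intro t ht
    have cE : ∀ t, IntegrableOn (fun x => φ (x, t) ^ 2) Ω := fun t =>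
      Continuous.integrableOn_of_isBounded ((hφc.comp (by fun_prop)).pow 2) hb
    have cI : Continuous fun x => ∫ t in (0 : ℝ)..T, |φ (x, t) * timeDeriv φ (x, t)| :=
      continuous_intervalIntegral_slice cA 0 T
    rw [← sub_le_iff_le_add', ← integral_sub (cE s) (cE t), hρ, integral_cylinder hb cA,
      ← integral_const_mul]
    refine setIntegral_mono_on ((cE s).sub (cE t)) ?_ hΩ.measurableSet fun x _ => ?_
    · simp_rw [← integral_Ioc_eq_integral_Ioo, ← intervalIntegral.integral_of_le hT.le]
      exact (continuous_const.mul cI).integrableOn_of_isBounded hb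
    · have c4 : Continuous fun t => 2 * φ (x, t) * timeDeriv φ (x, t) :=
        (continuous_const.mul (hφc.comp (by fun_prop))).mul
          ((continuous_timeDeriv hφ).comp (by fun_prop))
      have hftc := intervalIntegral.integral_eq_sub_of_hasDerivAt (a := t) (b := s)
        (f := fun t => φ (x, t) ^ 2) (fun t _ => ((hasDerivAt_timeSlice hφ x t).pow 2).congr_deriv (by
          simp [timeDeriv_eq hφ]))
        (c4.intervalIntegrable _ _)
      rw [← hftc, ← integral_const_mul]
      refine (le_abs_self _).trans ?_
      rw [← Real.norm_eq_abs, intervalIntegral.norm_intervalIntegral_eq]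
      refine (norm_integral_le_integral_norm _).trans ?_
      have cx : Continuous fun t => 2 * |φ (x, t) * timeDeriv φ (x, t)| :=
        continuous_const.mul (cA.comp (by fun_prop))
      rw [← integral_Ioc_eq_integral_Ioo]
      have hsub : uIoc t s ⊆ Ioc 0 T := by
        rw [uIoc]
        exact Ioc_subset_Ioc (le_min ht.1 hs.1) (max_le ht.2 hs.2)
      calc ∫ r in uIoc t s, ‖2 * φ (x, r) * timeDeriv φ (x, r)‖
          = ∫ r in uIoc t s, 2 * |φ (x, r) * timeDeriv φ (x, r)| := by
            refine integral_congr_ae (Eventually.of_forall fun r => ?_)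
            simp only
            rw [mul_assoc, norm_mul, Real.norm_eq_abs, Real.norm_eq_abs, abs_two]
        _ ≤ _ := setIntegral_mono_set (cx.integrableOn_of_isBounded (Metric.isBounded_Ioc 0 T))
            (Eventually.of_forall fun r => by positivity) (Eventually.of_forall hsub)
  have cE := continuous_energy hb hφc
  have cS : Continuous fun z => φ z ^ 2 := hφc.pow 2
  have cEρ : Continuous fun t => (∫ x in Ω, φ (x, t) ^ 2) + ρ := cE.add continuous_const
  have h1 : ∫ z in TransportObs.cylinder Ω T, φ z ^ 2 = ∫ t in (0 : ℝ)..T, ∫ x in Ω, φ (x, t) ^ 2 := by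
    rw [integral_cylinder hb cS, ← integral_integral_slices_comm hb
      cS 0 T hT.le]
    simp_rw [intervalIntegral.integral_of_le hT.le, integral_Ioc_eq_integral_Ioo]
  have h2 := intervalIntegral.integral_mono_on hT.le
    (intervalIntegrable_const (μ := volume) (c := ∫ x in Ω, φ (x, s) ^ 2))
    (cEρ.intervalIntegrable 0 T) hdiff
  rw [intervalIntegral.integral_add (cE.intervalIntegrable _ _) intervalIntegrable_const,
    intervalIntegral.integral_const, intervalIntegral.integral_const, ← h1] at h2
  simpa using h2

end Slices

/-- A uniform Cauchy criterion adapted to approximations with individual errors `γ n`: letting `m →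
∞` leaves the rate `γ n`. -/
theorem exists_continuousOn_limit {X E : Type*} [TopologicalSpace X] [NormedAddCommGroup E]
    [CompleteSpace E] {V : ℕ → X → E} {s : Set X} {γ : ℕ → ℝ} (hγ : Tendsto γ atTop (𝓝 0))
    (hV : ∀ n m, ∀ t ∈ s, ‖V n t - V m t‖ ≤ γ n + γ m) (hc : ∀ n, ContinuousOn (V n) s) :
    ∃ U : X → E, ContinuousOn U s ∧ ∀ n, ∀ t ∈ s, ‖V n t - U t‖ ≤ γ n := by
  have hcauchy : ∀ t ∈ s, CauchySeq fun n => V n t := fun t ht => by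
    refine Metric.cauchySeq_iff.2 fun ε hε => ?_
    obtain ⟨N, hN⟩ := eventually_atTop.1 (hγ.eventually_lt_const (half_pos hε))
    refine ⟨N, fun n hn m hm => ?_⟩
    rw [dist_eq_norm]
    linarith [hV n m t ht, hN n hn, hN m hm]
  have hlim : ∀ t, ∃ v, t ∈ s → Tendsto (fun n => V n t) atTop (𝓝 v) := fun t => by
    by_cases ht : t ∈ s
    · obtain ⟨v, hv⟩ := cauchySeq_tendsto_of_complete (hcauchy t ht)
      exact ⟨v, fun _ => hv⟩
    · exact ⟨0, fun h => absurd h ht⟩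
  choose U hU using hlim
  have hle : ∀ n, ∀ t ∈ s, ‖V n t - U t‖ ≤ γ n := fun n t ht => by
    refine le_of_tendsto_of_tendsto' ((tendsto_const_nhds.sub (hU t ht)).norm)
      (by simpa using hγ.const_add (γ n)) fun m => hV n m t ht
  refine ⟨U, ?_, hle⟩
  have hunif : TendstoUniformlyOn V U atTop s := by
    refine Metric.tendstoUniformlyOn_iff.2 fun ε hε => ?_
    filter_upwards [hγ.eventually_lt_const hε] with n hn t ht
    rw [dist_comm, dist_eq_norm]
    exact (hle n t ht).trans_lt hn
  exact hunif.continuousOn (Frequently.of_forall hc)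

theorem tendsto_toReal_zero {ι : Type*} {l : Filter ι} {f : ι → ℝ≥0∞} (h : Tendsto f l (𝓝 0)) :
    Tendsto (fun i => (f i).toReal) l (𝓝 0) := by
  simpa [Function.comp_def] using (ENNReal.tendsto_toReal ENNReal.zero_ne_top).comp h

theorem toReal_eLpNorm_add_le {α E : Type*} [MeasurableSpace α] [NormedAddCommGroup E]
    {μ : Measure α} {f g : α → E} (hf : MemLp f 2 μ) (hg : MemLp g 2 μ) :
    (eLpNorm (f + g) 2 μ).toReal ≤ (eLpNorm f 2 μ).toReal + (eLpNorm g 2 μ).toReal := by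
  rw [← ENNReal.toReal_add hf.2.ne hg.2.ne]
  exact ENNReal.toReal_mono (ENNReal.add_ne_top.2 ⟨hf.2.ne, hg.2.ne⟩)
    (eLpNorm_add_le hf.1 hg.1 one_le_two)

theorem toReal_eLpNorm_sub_le {α E : Type*} [MeasurableSpace α] [NormedAddCommGroup E]
    {μ : Measure α} {f g h : α → E} (hf : MemLp f 2 μ) (hg : MemLp g 2 μ) (hh : MemLp h 2 μ) :
    (eLpNorm (fun x => f x - g x) 2 μ).toReal ≤ (eLpNorm (fun x => f x - h x) 2 μ).toReal +
      (eLpNorm (fun x => g x - h x) 2 μ).toReal := by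
  have h1 : (fun x => f x - g x) = (fun x => f x - h x) + fun x => h x - g x := by
    ext x
    simp
  rw [h1]
  refine (toReal_eLpNorm_add_le (hf.sub hh) (hh.sub hg)).trans_eq ?_
  congr 2
  exact eLpNorm_sub_comm h g 2 μ

section

variable {d : ℕ} {Ω : Set (Space d)} {T : ℝ}

theorem isBounded_cylinder (hb : Bornology.IsBounded Ω) :
    Bornology.IsBounded (TransportObs.cylinder Ω T) :=
  hb.prod (Metric.isBounded_Ioo 0 T)

theorem timeDeriv_sub {φ ψ : Space d × ℝ → ℝ} (hφ : ContDiff ℝ ∞ φ) (hψ : ContDiff ℝ ∞ ψ) :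
    timeDeriv (fun z => φ z - ψ z) = fun z => timeDeriv φ z - timeDeriv ψ z := by
  ext z
  rw [timeDeriv_eq hφ, timeDeriv_eq hψ, timeDeriv_eq (hφ.sub hψ),
    fderiv_fun_sub (hφ.differentiable (by simp) z) (hψ.differentiable (by simp) z)]
  rfl

/-- A limit of smooth functions in `H¹(Q)` has a representative in `C([0,T]; L²(Ω))`, which is the
uniform limit of the slices of the approximating functions. -/
theorem exists_isTimeSlices (hΩ : IsOpen Ω) (hb : Bornology.IsBounded Ω) (hT : 0 < T)
    (u : SobolevH1 (TransportObs.cylinder Ω T)) {φ : ℕ → Space d × ℝ → ℝ}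
    (hφ : ∀ n, ContDiff ℝ ∞ (φ n)) (hlim : TendstoH1 φ u) :
    ∃ U : ℝ → Lp ℝ 2 (volume.restrict Ω), IsTimeSlices u U ∧ ∀ s ∈ Icc 0 T,
      Tendsto (fun n => sliceLp hb (hφ n).continuous s) atTop (𝓝 (U s)) := by
  have hQb : Bornology.IsBounded (TransportObs.cylinder Ω T) := isBounded_cylinder hb
  obtain ⟨hv, -, ht⟩ := hlim
  have hφc := fun n => (hφ n).continuous
  have hφm := fun n => (hφc n).memLp_of_isBounded (μ := volume) hQb 2
  have hφtm := fun n => (continuous_timeDeriv (hφ n)).memLp_of_isBounded (μ := volume) hQb 2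
  set α : ℕ → ℝ := fun n => (eLpNorm (fun z => φ n z - u.val z) 2
    (volume.restrict (TransportObs.cylinder Ω T))).toReal with hα
  set β : ℕ → ℝ :=
    fun n => (eLpNorm (fun z => timeDeriv (φ n) z - u.dt z) 2
      (volume.restrict (TransportObs.cylinder Ω T))).toReal with hβ
  have hα0 : Tendsto α atTop (𝓝 0) :=
    tendsto_toReal_zero hv
  have hβ0 : Tendsto β atTop (𝓝 0) :=
    tendsto_toReal_zero ht
  -- For a difference of approximations whose L²(Q) norm and that of its time derivative are at most
  -- W, `energy_le_of_timeDeriv` gives T·E ≤ W² + 2T·W², that is E ≤ (1/T + 2)W².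
  set K := Real.sqrt (1 / T + 2) with hK
  have hKsq : K ^ 2 = 1 / T + 2 := Real.sq_sqrt (by positivity)
  have hK0 : 0 ≤ K := Real.sqrt_nonneg _
  have hVV : ∀ n m, ∀ s ∈ Icc 0 T,
      ‖sliceLp hb (hφc n) s - sliceLp hb (hφc m) s‖ ≤ K * (α n + β n) + K * (α m + β m) := by
    intro n m s hs
    have hsub : sliceLp hb (hφc n) s - sliceLp hb (hφc m) s =
        sliceLp hb ((hφc n).sub (hφc m)) s := by
      rw [sliceLp, sliceLp, ← MemLp.toLp_sub]
      rfl
    have h1 := energy_le_of_timeDeriv hΩ hb hT ((hφ n).sub (hφ m)) hs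
    simp only [timeDeriv_sub (hφ n) (hφ m)] at h1
    have hN := toReal_eLpNorm_sub_le (hφm n) (hφm m) u.memLp_val
    have hNt := toReal_eLpNorm_sub_le (hφtm n) (hφtm m) u.memLp_dt
    have h2 := integral_abs_mul_le_eLpNorm_two ((hφm n).sub (hφm m)) ((hφtm n).sub (hφtm m))
    have h3 := toReal_eLpNorm_two_sq ((hφm n).sub (hφm m)).1
    simp only [Pi.sub_apply, Real.norm_eq_abs, sq_abs] at h2 h3
    rw [hsub]
    set N := (eLpNorm (fun z => φ n z - φ m z) 2
      (volume.restrict (TransportObs.cylinder Ω T))).toReal with hNdef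
    set N' := (eLpNorm (fun z => timeDeriv (φ n) z - timeDeriv (φ m) z) 2
      (volume.restrict (TransportObs.cylinder Ω T))).toReal with hN'def
    have hN0 : 0 ≤ N := ENNReal.toReal_nonneg
    have hN'0 : 0 ≤ N' := ENNReal.toReal_nonneg
    change N ≤ α n + α m at hN
    change N' ≤ β n + β m at hNt
    change _ ≤ N * N' at h2
    change N ^ 2 = _ at h3
    have hαn : ∀ n, 0 ≤ α n := fun n => ENNReal.toReal_nonneg
    have hβn : ∀ n, 0 ≤ β n := fun n => ENNReal.toReal_nonneg
    refine abs_le_of_sq_le_sq' ?_ (by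
      have := hαn n; have := hαn m; have := hβn n; have := hβn m; positivity) |>.2
    rw [norm_sliceLp_sq hb]
    set W := α n + β n + (α m + β m) with hW
    have hNW : N ≤ W := by linarith [hβn n, hβn m]
    have hN'W : N' ≤ W := by linarith [hαn n, hαn m]
    have e1 : N ^ 2 ≤ W ^ 2 := by gcongr
    have e2 : N * N' ≤ W ^ 2 := by rw [sq]; gcongr
    have e3 : T * ∫ x in Ω, (φ n (x, s) - φ m (x, s)) ^ 2 ≤ T * ((1 / T + 2) * W ^ 2) := by
      calc _ ≤ _ := h1
        _ ≤ W ^ 2 + T * (2 * W ^ 2) := by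
          rw [← h3]
          gcongr
          exact h2.trans e2
        _ = _ := by field_simp
    calc _ ≤ (1 / T + 2) * W ^ 2 := le_of_mul_le_mul_left e3 hT
      _ = _ := by rw [← hKsq, hW]; ring
  have hγ0 : Tendsto (fun n => K * (α n + β n)) atTop (𝓝 0) := by
    simpa using (hα0.add hβ0).const_mul K
  obtain ⟨U, hUc, hU⟩ := exists_continuousOn_limit hγ0 hVV
    fun n => (continuous_sliceLp hb (hφc n)).continuousOn
  refine ⟨U, ⟨hUc, ?_⟩, fun s hs => tendsto_iff_norm_sub_tendsto_zero.2
    (squeeze_zero (fun n => norm_nonneg _) (fun n => hU n s hs) hγ0)⟩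
  have hprod : volume.restrict (TransportObs.cylinder Ω T) =
      (volume.restrict Ω).prod (volume.restrict (Ioo 0 T)) := by
    rw [TransportObs.cylinder, Measure.volume_eq_prod, Measure.prod_restrict]
  have hdm : ∀ n, AEStronglyMeasurable (fun z => φ n z - u.val z)
      ((volume.restrict Ω).prod (volume.restrict (Ioo 0 T))) := fun n => by
    rw [← hprod]
    exact ((hφm n).sub u.memLp_val).1
  have hDm : ∀ n, AEMeasurable (fun z => ‖φ n z - u.val z‖ₑ ^ 2)
      ((volume.restrict Ω).prod (volume.restrict (Ioo 0 T))) := fun n =>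
    (hdm n).enorm.pow_const 2
  -- By Tonelli the squared distances of the slices of `φ n` and `u` tend to zero in L¹(0,T). For
  -- almost every `t` they are therefore small for infinitely many `n`, while the slices are close
  -- to `U t` for all large `n`; some `n` does both.
  have hliminf := ae_liminf_eq_zero_of_tendsto_lintegral
    (fun n => AEMeasurable.lintegral_prod_left' (hDm n)) (by
      simp_rw [← fun n => lintegral_prod_symm _ (hDm n), ← hprod, lintegral_enorm_sq_eq]
      simpa using ENNReal.Tendsto.pow (n := 2) hv)
  have hum : ∀ᵐ t ∂volume.restrict (Ioo 0 T),
      AEStronglyMeasurable (fun x => u.val (x, t)) (volume.restrict Ω) := by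
    have := u.memLp_val.1
    rw [hprod] at this
    exact this.prod_swap.prodMk_left
  filter_upwards [hliminf, hum, ae_restrict_mem measurableSet_Ioo] with t ht hut htm
  have htI : t ∈ Icc 0 T := Ioo_subset_Icc_self htm
  have hslice : ∀ n, AEStronglyMeasurable (fun x => φ n (x, t)) (volume.restrict Ω) := fun n =>
    ((hφc n).comp (by fun_prop : Continuous fun x : Space d => (x, t))).aestronglyMeasurable
  have hUt := (Lp.memLp (U t)).1
  suffices h : eLpNorm (fun x => U t x - u.val (x, t)) 2 (volume.restrict Ω) = 0 by
    filter_upwards [(eLpNorm_eq_zero_iff (hUt.sub hut) two_ne_zero).1 h] with x hx using sub_eq_zero.1 hx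
  refine le_antisymm (le_of_forall_pos_le_add fun ε hε => ?_) zero_le
  rw [zero_add]
  have hε2 : 0 < ε / 2 := ENNReal.div_pos hε.ne' (by simp)
  have hfreq : ∃ᶠ n in atTop, ∫⁻ x in Ω, ‖φ n (x, t) - u.val (x, t)‖ₑ ^ 2 < (ε / 2) ^ 2 :=
    frequently_lt_of_liminf_lt (by isBoundedDefault) (by rw [ht]; exact ENNReal.pow_pos hε2 2)
  have hev : ∀ᶠ n in atTop, ENNReal.ofReal (K * (α n + β n)) < ε / 2 := by
    have : Tendsto (fun n => ENNReal.ofReal (K * (α n + β n))) atTop (𝓝 0) := by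
      simpa using ENNReal.tendsto_ofReal hγ0
    exact this.eventually_lt_const hε2
  obtain ⟨n, hn1, hn2⟩ := (hfreq.and_eventually hev).exists
  rw [lintegral_enorm_sq_eq (volume.restrict Ω) fun x => φ n (x, t) - u.val (x, t)] at hn1
  have hn3 : eLpNorm (fun x => U t x - φ n (x, t)) 2 (volume.restrict Ω) ≤ ε / 2 := by
    have h1 := hU n t htI
    rw [norm_sub_rev, Lp.norm_def] at h1
    have h2 : eLpNorm (fun x => U t x - φ n (x, t)) 2 (volume.restrict Ω) =
        eLpNorm (U t - sliceLp hb (hφc n) t : Lp ℝ 2 (volume.restrict Ω)) 2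
          (volume.restrict Ω) := by
      refine eLpNorm_congr_ae ?_
      filter_upwards [Lp.coeFn_sub (U t) (sliceLp hb (hφc n) t), MemLp.coeFn_toLp
        (((hφc n).comp (by fun_prop : Continuous fun x : Space d => (x, t))).memLp_of_isBounded
          (μ := volume) hb 2)] with x h1 h2
      rw [h1, Pi.sub_apply, sliceLp, h2]
      rfl
    rw [h2, ← ENNReal.ofReal_toReal (Lp.eLpNorm_ne_top _)]
    exact (ENNReal.ofReal_le_ofReal h1).trans hn2.le
  calc eLpNorm (fun x => U t x - u.val (x, t)) 2 (volume.restrict Ω)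
      = eLpNorm ((fun x => U t x - φ n (x, t)) + fun x => φ n (x, t) - u.val (x, t)) 2
          (volume.restrict Ω) := by
        congr 1
        ext x
        simp
    _ ≤ ε / 2 + ε / 2 := (eLpNorm_add_le (hUt.sub (hslice n)) ((hslice n).sub hut)
        one_le_two).trans (add_le_add hn3 (lt_of_pow_lt_pow_left' 2 hn1).le)
    _ = ε := ENNReal.add_halves ε

end

/-! ### From the energy estimate to observability. -/

section Observability

variable {d : ℕ} {Ω : Set (Space d)} {T a b : ℝ} {H : ℝ → Space d} {φ : Space d × ℝ → ℝ}

/-- Observability up to the residual, for smooth functions: if the transport over `[a, b]` in the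
direction `η` exceeds twice the width of the domain, then the boundary values control the energy. -/
theorem energy_le_of_residual (hd : 1 ≤ d) (hΩ : IsOpen Ω) (hb : Bornology.IsBounded Ω)
    (ha0 : 0 ≤ a) (hab : a ≤ b) (hbT : b ≤ T) (hH : Continuous H) {h : ℝ} (hh : 0 ≤ h)
    (hHh : ∀ t ∈ Icc 0 T, ‖H t‖ ≤ h) (hφ : ContDiff ℝ ∞ φ) {η : Space d} {δ σ : ℝ} (hδ0 : 0 ≤ δ)
    (hδ : ∀ x ∈ closure Ω, |⟪η, x⟫_ℝ| ≤ δ) (hσ0 : 0 ≤ σ) (hσ : ∀ t ∈ Icc a b, σ ≤ ⟪H t, η⟫_ℝ)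
    {B : ℝ} (hB0 : 0 ≤ B)
    (hB : ∫⁻ z, ‖φ z‖ₑ ^ 2 ∂lateralMeasure Ω T ≤ ENNReal.ofReal B) {s : ℝ} (hs : s ∈ Icc 0 T) :
    (σ * (b - a) - 2 * δ) * ∫ x in Ω, φ (x, s) ^ 2 ≤
      (σ * (b - a) + 3 * δ) * (2 * (∫ z in TransportObs.cylinder Ω T,
        |φ z * transportResidual H φ z|) + d * (2 * (h * B))) := by
  have hφc := hφ.continuous
  set X := 2 * (∫ z in TransportObs.cylinder Ω T, |φ z * transportResidual H φ z|) +
    d * (2 * (h * B)) with hX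
  -- The constant weight 1: the energy is conserved up to `X`.
  have hcomp : ∀ p q, 0 ≤ p → p ≤ q → q ≤ T →
      |(∫ x in Ω, φ (x, q) ^ 2) - ∫ x in Ω, φ (x, p) ^ 2| ≤ X := fun p q hp hpq hq => by
    have := abs_energy_sub_le hd hΩ hb hp hpq hq hH hh hHh hφ (c := 1) (P := 1) (η := 0)
      zero_le_one (fun x _ => by simp) hB0 hB
    simpa [hX, abs_mul] using this
  have hcomp' : ∀ p ∈ Icc 0 T, ∀ q ∈ Icc 0 T,
      (∫ x in Ω, φ (x, q) ^ 2) ≤ (∫ x in Ω, φ (x, p) ^ 2) + X := fun p hp q hq => by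
    rcases le_total p q with h' | h'
    · linarith [(abs_le.1 (hcomp p q hp.1 h' hq.2)).2]
    · linarith [(abs_le.1 (hcomp q p hq.1 h' hp.2)).1]
  have hE0 : ∀ t, 0 ≤ ∫ x in Ω, φ (x, t) ^ 2 := fun t => integral_nonneg fun x => sq_nonneg _
  have haT : a ∈ Icc 0 T := ⟨ha0, hab.trans hbT⟩
  have hbI : b ∈ Icc 0 T := ⟨ha0.trans hab, hbT⟩
  -- The linear weight ⟪η,x⟫, whose derivative along the flow is ⟪H,η⟫ ≥ σ.
  have hw := abs_energy_sub_le hd hΩ hb ha0 hab hbT hH hh hHh hφ (c := 0) (P := δ) (η := η) hδ0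
    (by simpa using hδ) hB0 hB
  simp only [zero_add] at hw
  have hwE : ∀ t, |∫ x in Ω, φ (x, t) ^ 2 * ⟪η, x⟫_ℝ| ≤ δ * ∫ x in Ω, φ (x, t) ^ 2 := fun t => by
    have c1 : Continuous fun x => φ (x, t) ^ 2 := (hφc.comp (by fun_prop)).pow 2
    have c2 : Continuous fun x => ‖φ (x, t) ^ 2 * ⟪η, x⟫_ℝ‖ :=
      (c1.mul (by fun_prop)).norm
    have c3 : Continuous fun x => δ * φ (x, t) ^ 2 := continuous_const.mul c1
    rw [← integral_const_mul, ← Real.norm_eq_abs]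
    refine (norm_integral_le_integral_norm _).trans (setIntegral_mono_on
      (c2.integrableOn_of_isBounded hb) (c3.integrableOn_of_isBounded hb) hΩ.measurableSet
      fun x hx => ?_)
    rw [norm_mul, Real.norm_eq_abs, Real.norm_eq_abs, abs_of_nonneg (sq_nonneg _), mul_comm]
    gcongr
    exact hδ x (subset_closure hx)
  have hlow : σ * (b - a) * ((∫ x in Ω, φ (x, s) ^ 2) - X) ≤
      ∫ x in Ω, ∫ t in a..b, φ (x, t) ^ 2 * ⟪H t, η⟫_ℝ := by
    have c1 : Continuous fun z : Space d × ℝ => φ z ^ 2 * ⟪H z.2, η⟫_ℝ :=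
      (hφc.pow 2).mul ((hH.comp continuous_snd).inner continuous_const)
    rw [integral_integral_slices_comm hb c1 a b hab]
    simp_rw [integral_mul_const]
    have c2 : Continuous fun t => (∫ x in Ω, φ (x, t) ^ 2) * ⟪H t, η⟫_ℝ :=
      (continuous_energy hb hφc).mul (hH.inner continuous_const)
    calc σ * (b - a) * ((∫ x in Ω, φ (x, s) ^ 2) - X)
        = ∫ _ in a..b, ((∫ x in Ω, φ (x, s) ^ 2) - X) * σ := by
          rw [intervalIntegral.integral_const, smul_eq_mul]
          ring
      _ ≤ _ := by
          refine intervalIntegral.integral_mono_on hab intervalIntegrable_const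
            (c2.intervalIntegrable _ _) fun t ht => ?_
          have h1 := hcomp' t ⟨ha0.trans ht.1, ht.2.trans hbT⟩ s hs
          calc ((∫ x in Ω, φ (x, s) ^ 2) - X) * σ ≤ (∫ x in Ω, φ (x, t) ^ 2) * σ := by
                gcongr
                linarith
            _ ≤ _ := mul_le_mul_of_nonneg_left (hσ t ht) (hE0 t)
  -- With E the energy at time `s`: σ(b-a)(E - X) ≤ δE(b) + δE(a) + δX ≤ 2δ(E + X) + δX, whence the
  -- coefficients σ(b-a) - 2δ and σ(b-a) + 3δ.
  have h1 := (abs_le.1 hw).1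
  have h2 := (abs_le.1 (hwE b)).2
  have h3 := (abs_le.1 (hwE a)).1
  have h4 := mul_le_mul_of_nonneg_left (hcomp' s hs a haT) hδ0
  have h5 := mul_le_mul_of_nonneg_left (hcomp' s hs b hbI) hδ0
  have h6 : 2 * δ * (∫ z in TransportObs.cylinder Ω T, |φ z * transportResidual H φ z|) +
      d * (2 * (h * δ * B)) = δ * X := by
    rw [hX]
    ring
  rw [h6] at h1
  linarith

/-- The residual of smooth approximations of a solution tends to zero in `L²(Q)`. -/
theorem tendsto_eLpNorm_transportResidual (hΩ : IsOpen Ω) (hb : Bornology.IsBounded Ω)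
    (hH : Continuous H) {h : ℝ} (hHh : ∀ t ∈ Icc 0 T, ‖H t‖ ≤ h)
    {u : SobolevH1 (TransportObs.cylinder Ω T)} (hu : SolvesTransport H u)
    {φ : ℕ → Space d × ℝ → ℝ} (hφ : ∀ n, ContDiff ℝ ∞ (φ n)) (hlim : TendstoH1 φ u) :
    Tendsto (fun n => eLpNorm (transportResidual H (φ n)) 2
      (volume.restrict (TransportObs.cylinder Ω T))) atTop (𝓝 0) := by
  obtain ⟨-, hg, ht⟩ := hlim
  have hQm : MeasurableSet (TransportObs.cylinder Ω T) := hΩ.measurableSet.prod measurableSet_Ioo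
  have hmem := fun n => (continuous_timeDeriv (hφ n)).memLp_of_isBounded (μ := volume)
    (isBounded_cylinder (T := T) hb) 2
  have hgmem := fun n => (continuous_spaceGrad (hφ n)).memLp_of_isBounded (μ := volume)
    (isBounded_cylinder (T := T) hb) 2
  have hsum : Tendsto (fun n => eLpNorm (fun z => timeDeriv (φ n) z - u.dt z) 2
      (volume.restrict (TransportObs.cylinder Ω T)) + ENNReal.ofReal h *
        eLpNorm (fun z => spaceGrad (φ n) z - u.grad z) 2
          (volume.restrict (TransportObs.cylinder Ω T))) atTop (𝓝 0) := by
    simpa using ht.add (ENNReal.Tendsto.const_mul (a := ENNReal.ofReal h) hg (by simp))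
  refine tendsto_of_tendsto_of_tendsto_of_le_of_le tendsto_const_nhds hsum (fun n => zero_le)
    fun n => ?_
  -- Subtracting the equation for `u` expresses the residual through the errors of the derivatives.
  have hae : transportResidual H (φ n) =ᵐ[volume.restrict (TransportObs.cylinder Ω T)]
      (fun z => timeDeriv (φ n) z - u.dt z) + fun z => ⟪H z.2, spaceGrad (φ n) z - u.grad z⟫_ℝ := by
    filter_upwards [hu] with z hz
    simp only [transportResidual, Pi.add_apply, inner_sub_right]
    linarith
  have hHm : AEStronglyMeasurable (fun z : Space d × ℝ => H z.2)
      (volume.restrict (TransportObs.cylinder Ω T)) :=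
    (hH.comp continuous_snd).aestronglyMeasurable
  rw [eLpNorm_congr_ae hae]
  refine (eLpNorm_add_le ((hmem n).sub u.memLp_dt).1 (hHm.inner ((hgmem n).sub u.memLp_grad).1)
    one_le_two).trans (add_le_add le_rfl (eLpNorm_le_mul_eLpNorm_of_ae_le_mul ?_ 2))
  filter_upwards [ae_restrict_mem hQm] with z hz
  exact (norm_inner_le_norm _ _).trans (mul_le_mul_of_nonneg_right
    (hHh z.2 (Ioo_subset_Icc_self hz.2)) (norm_nonneg _))

/-- Observability of the transport equation, under a lower bound for the displacement in a fixed
direction during a time interval. -/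
theorem exists_observability (hd : 1 ≤ d) (hΩ : IsOpen Ω) (hb : Bornology.IsBounded Ω) (hT : 0 < T)
    (ha0 : 0 ≤ a) (hab : a ≤ b) (hbT : b ≤ T) (hH : Continuous H) {h : ℝ} (hh : 0 ≤ h)
    (hHh : ∀ t ∈ Icc 0 T, ‖H t‖ ≤ h) {η : Space d} {δ σ : ℝ} (hδ0 : 0 ≤ δ)
    (hδ : ∀ x ∈ closure Ω, |⟪η, x⟫_ℝ| ≤ δ) (hσ0 : 0 ≤ σ) (hσ : ∀ t ∈ Icc a b, σ ≤ ⟪H t, η⟫_ℝ)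
    (hgap : 2 * δ < σ * (b - a)) :
    ∃ C : ℝ, 0 < C ∧
      ∀ (g : Lp ℝ 2 (lateralMeasure Ω T)) (u : SobolevH1 (TransportObs.cylinder Ω T)),
        SolvesTransport H u → HasLateralTrace u g →
          ∃ U : ℝ → Lp ℝ 2 (volume.restrict Ω), IsTimeSlices u U ∧
            ∀ s ∈ Icc 0 T, ‖U s‖ ≤ C * ‖g‖ := by
  set A := σ * (b - a) with hA
  have hpos : 0 < A - 2 * δ := by linarith
  -- What `energy_le_of_residual` leaves when the residual vanishes and B = ‖g‖². The summand 1
  -- added to the root below only makes the constant positive, as κ may be zero.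
  set κ := (A + 3 * δ) * (d * (2 * h)) / (A - 2 * δ) with hκ
  have hκ0 : 0 ≤ κ := div_nonneg (mul_nonneg (by linarith) (by positivity)) hpos.le
  refine ⟨Real.sqrt κ + 1, by positivity, fun g u hu ⟨φ, hφ, hlim, htr⟩ => ?_⟩
  obtain ⟨U, hU, hUlim⟩ := exists_isTimeSlices hΩ hb hT u hφ hlim
  refine ⟨U, hU, fun s hs => ?_⟩
  have hQb := isBounded_cylinder (T := T) hb
  have hφm := fun n => (hφ n).continuous.memLp_of_isBounded (μ := volume) hQb 2
  have hrm := fun n => (continuous_transportResidual hH (hφ n)).memLp_of_isBounded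
    (μ := volume) hQb 2
  set ρ : ℕ → ℝ := fun n => ∫ z in TransportObs.cylinder Ω T,
    |φ n z * transportResidual H (φ n) z| with hρ
  set α : ℕ → ℝ := fun n => (eLpNorm (fun z => φ n z - u.val z) 2
    (volume.restrict (TransportObs.cylinder Ω T))).toReal with hα
  set N : ℝ := (eLpNorm u.val 2 (volume.restrict (TransportObs.cylinder Ω T))).toReal with hN
  set θ : ℕ → ℝ := fun n => (eLpNorm (fun z => φ n z - g z) 2 (lateralMeasure Ω T)).toReal with hθ
  have hα0 : Tendsto α atTop (𝓝 0) := tendsto_toReal_zero hlim.1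
  have hθ0 : Tendsto θ atTop (𝓝 0) := tendsto_toReal_zero htr
  have hr0 := tendsto_toReal_zero (tendsto_eLpNorm_transportResidual hΩ hb hH hHh hu hφ hlim)
  have hρ0 : Tendsto ρ atTop (𝓝 0) := by
    refine squeeze_zero (fun n => integral_nonneg fun z => abs_nonneg _) (fun n => ?_)
      (by simpa using (hα0.add_const N).mul hr0)
    refine (integral_abs_mul_le_eLpNorm_two (hφm n) (hrm n)).trans ?_
    gcongr
    have := toReal_eLpNorm_add_le ((hφm n).sub u.memLp_val) u.memLp_val
    rwa [sub_add_cancel] at this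
  have hle : ∀ᶠ n in atTop, (A - 2 * δ) * ‖sliceLp hb (hφ n).continuous s‖ ^ 2 ≤
      (A + 3 * δ) * (2 * ρ n + d * (2 * (h * (θ n + ‖g‖) ^ 2))) := by
    -- Only for large `n` is `φ n - g`, and hence `φ n`, known to have finite L² norm on the lateral
    -- boundary.
    filter_upwards [htr.eventually_lt_const ENNReal.zero_lt_top] with n hn
    rw [norm_sliceLp_sq hb]
    refine energy_le_of_residual hd hΩ hb ha0 hab hbT hH hh hHh (hφ n) hδ0 hδ hσ0 hσ
      (sq_nonneg _) ?_ hs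
    have hm : MemLp (fun z => φ n z - g z) 2 (lateralMeasure Ω T) :=
      ⟨(hφ n).continuous.aestronglyMeasurable.sub (Lp.memLp g).1, hn⟩
    have h1 := toReal_eLpNorm_add_le hm (Lp.memLp g)
    have h2 : ((fun z => φ n z - g z) + g : Space d × ℝ → ℝ) = φ n := by
      ext z
      simp
    rw [h2, ← Lp.norm_def] at h1
    have h3 : MemLp (φ n) 2 (lateralMeasure Ω T) := h2 ▸ hm.add (Lp.memLp g)
    rw [lintegral_enorm_sq_eq, ENNReal.ofReal_pow (add_nonneg ENNReal.toReal_nonneg (norm_nonneg _)),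
      ← ENNReal.ofReal_toReal h3.2.ne]
    gcongr
  have hfin : (A - 2 * δ) * ‖U s‖ ^ 2 ≤ (A + 3 * δ) * (2 * 0 + d * (2 * (h * (0 + ‖g‖) ^ 2))) :=
    le_of_tendsto_of_tendsto (((hUlim s hs).norm.pow 2).const_mul _)
      (((hρ0.const_mul 2).add (((((hθ0.add_const ‖g‖).pow 2).const_mul h).const_mul 2).const_mul
        (d : ℝ))).const_mul _) hle
  have hsq : ‖U s‖ ^ 2 ≤ κ * ‖g‖ ^ 2 := by
    rw [hκ, div_mul_eq_mul_div, le_div_iff₀ hpos]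
    linarith
  have h0 : ‖U s‖ ≤ Real.sqrt κ * ‖g‖ := by
    refine abs_le_of_sq_le_sq' ?_ (by positivity) |>.2
    rwa [mul_pow, Real.sq_sqrt hκ0]
  linarith [norm_nonneg g]

end Observability

/-! ### Geometry of the points x_j, and conclusion. -/

section Geometry

variable {d : ℕ} {Ω : Set (Space d)} {T : ℝ} {H : ℝ → Space d}

theorem minSpeed_le {s : ℝ} (hs : s ∈ Icc 0 T) : minSpeed H T ≤ ‖H s‖ :=
  csInf_le ⟨0, by rintro _ ⟨t, -, rfl⟩; exact norm_nonneg _⟩ ⟨s, hs, rfl⟩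

theorem TransportObs.IsPartition.mono {m : ℕ} {t : ℕ → ℝ} (ht : IsPartition T m t) {i k : ℕ} (hik : i ≤ k)
    (hk : k ≤ m) : t i ≤ t k := by
  induction k, hik using Nat.le_induction with
  | base => exact le_rfl
  | succ k hik ih => exact (ih (by omega)).trans (ht.lt_succ k (by omega)).le

theorem minDist_le (h0 : (0 : Space d) ∈ closure Ω) (y : Space d) : minDist Ω y ≤ ‖y‖ := by
  simpa [minDist] using csInf_le (s := (fun x => ‖x - y‖) '' closure Ω)
    ⟨0, by rintro _ ⟨t, -, rfl⟩; exact norm_nonneg _⟩ ⟨0, h0, rfl⟩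

theorem le_maxDist (hb : Bornology.IsBounded Ω) (h0 : (0 : Space d) ∈ closure Ω) (y : Space d) :
    ‖y‖ ≤ maxDist Ω y := by
  simpa [maxDist] using le_csSup (s := (fun x => ‖x - y‖) '' closure Ω)
    (hb.isCompact_closure.image (by fun_prop)).bddAbove ⟨0, h0, rfl⟩

/-- (1 + S)/(1 - S) ≥ 2 exactly when S ≥ 1/3 (for S < 1), and the dependence on `j` and `r` only
enlarges the radius. -/
theorem two_mul_diam_le_radius {S r : ℝ} (hS : 1 / 3 ≤ S) (hS1 : S < 1) (hr : 0 ≤ r) (j : ℕ) :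
    2 * Metric.diam Ω ≤ radius Ω S r j := by
  have hδ : 0 ≤ Metric.diam Ω := Metric.diam_nonneg
  have h1 : 2 ≤ (1 + S) / (1 - S) := by
    rw [le_div_iff₀ (by linarith)]
    linarith
  have h2 : (1 : ℝ) ≤ 2 ^ j := one_le_pow₀ one_le_two
  have h3 : 2 * Metric.diam Ω ≤ (1 + S) / (1 - S) * Metric.diam Ω := by gcongr
  have h4 : (1 + S) / (1 - S) * Metric.diam Ω ≤ 2 ^ j * ((1 + S) / (1 - S) * Metric.diam Ω) :=
    le_mul_of_one_le_left (by linarith) h2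
  have h5 : 0 ≤ (2 ^ j - 1) * (Metric.diam Ω + r) := mul_nonneg (by linarith) (by linarith)
  rw [radius]
  linarith

end Geometry

theorem theorem1p6 {d : ℕ} (hd : 1 ≤ d)
    (Ω : Set (Space d)) (hΩ : IsSmoothBoundedDomain Ω) (h0 : (0 : Space d) ∈ closure Ω)
    (T : ℝ) (hT : 0 < T)
    (H : ℝ → Space d) (hH : ContDiffOn ℝ 1 H (Icc 0 T)) (hH0 : 0 < minSpeed H T)
    (S : ℝ) (hS : 1 / Real.sqrt 2 < S) (hS1 : S < 1) (r : ℝ) (hr : 0 < r)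
    (m : ℕ) (t : ℕ → ℝ) (ht : IsPartition T m t) (hangle : AngleCondition H S m t)
    (hmax : ∃ j < m,
      1 / (minSpeed H T * (2 * S ^ 2 - 1)) <
        (t (j + 1) - t j) * minDist Ω (point Ω H S r t j) /
          maxDist Ω (point Ω H S r t j) ^ 2) :
    ∃ C : ℝ, 0 < C ∧
      ∀ (g : Lp ℝ 2 (lateralMeasure Ω T)) (u : SobolevH1 (cylinder Ω T)),
        SolvesTransport H u → HasLateralTrace u g →
          ∃ U : ℝ → Lp ℝ 2 (volume.restrict Ω), IsTimeSlices u U ∧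
            ∀ s ∈ Icc 0 T, ‖U s‖ ≤ C * ‖g‖ := by
  obtain ⟨j, hj, hmax⟩ := hmax
  have hb := hΩ.isBounded
  have hja : 0 ≤ t j := ht.zero ▸ ht.mono (Nat.zero_le j) hj.le
  have hjb : t (j + 1) ≤ T := ht.last ▸ ht.mono hj le_rfl
  have hjj := ht.lt_succ j hj
  have hS0 : 0 < S := lt_trans (by positivity) hS
  have hSsq : 1 / 2 < S ^ 2 := by
    have h1 : (1 / Real.sqrt 2) ^ 2 < S ^ 2 := by gcongr
    rwa [div_pow, Real.sq_sqrt two_pos.le, one_pow] at h1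
  have hSthird : 1 / 3 ≤ S := by nlinarith
  have hHj : 0 < ‖H (t j)‖ := hH0.trans_le (minSpeed_le ⟨hja, hjj.le.trans hjb⟩)
  have hη : ‖eta H t j‖ = 1 := by
    rw [eta, norm_smul, norm_inv, norm_norm, inv_mul_cancel₀ hHj.ne']
  have hδ : ∀ x ∈ closure Ω, |⟪eta H t j, x⟫_ℝ| ≤ Metric.diam Ω := fun x hx => by
    refine (abs_real_inner_le_norm _ _).trans ?_
    rw [hη, one_mul, ← dist_zero_right, ← Metric.diam_closure]
    exact Metric.dist_le_diam_of_mem hb.closure hx h0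
  -- As 0 lies in the closure, d ≤ |y| ≤ M, so one factor M cancels in the hypothesis: 2 diam Ω ≤
  -- |y| ≤ M < Δt·H₀(2S²-1). Finally 2S²-1 ≤ S, because (2S+1)(S-1) ≤ 0.
  have hgap : 2 * Metric.diam Ω < minSpeed H T * S * (t (j + 1) - t j) := by
    set y := point Ω H S r t j with hy
    have hR := two_mul_diam_le_radius (Ω := Ω) hSthird hS1 hr.le j
    have hδ0 : 0 ≤ Metric.diam Ω := Metric.diam_nonneg
    have hynorm : ‖y‖ = radius Ω S r j := by
      rw [hy, point, norm_neg, norm_smul, hη, mul_one, Real.norm_of_nonneg (by linarith)]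
    have hM := le_maxDist hb h0 y
    have hD := (minDist_le h0 y).trans hM
    have hq : 0 < 2 * S ^ 2 - 1 := by linarith
    have hM0 : 0 < maxDist Ω y := by
      -- If M were 0, the quotient in `hmax` would be 0 by the convention for division by zero, and
      -- could not exceed a positive number.
      refine lt_of_le_of_ne ((norm_nonneg y).trans hM) fun h => ?_
      rw [← h] at hmax
      have : 0 < 1 / (minSpeed H T * (2 * S ^ 2 - 1)) := by positivity
      simp only [ne_eq, OfNat.ofNat_ne_zero, not_false_eq_true, zero_pow, div_zero] at hmax
      linarith
    have hΔ : 0 < t (j + 1) - t j := sub_pos.2 hjj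
    rw [div_lt_div_iff₀ (by positivity) (by positivity)] at hmax
    have h1 : maxDist Ω y * maxDist Ω y <
        (t (j + 1) - t j) * (minSpeed H T * (2 * S ^ 2 - 1)) * maxDist Ω y := by
      have h2 : (t (j + 1) - t j) * minDist Ω y * (minSpeed H T * (2 * S ^ 2 - 1)) ≤
          (t (j + 1) - t j) * maxDist Ω y * (minSpeed H T * (2 * S ^ 2 - 1)) := by gcongr
      linarith
    have h2 := lt_of_mul_lt_mul_right h1 hM0.le
    have h3 : (t (j + 1) - t j) * (minSpeed H T * (2 * S ^ 2 - 1)) ≤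
        (t (j + 1) - t j) * (minSpeed H T * S) := by
      gcongr
      nlinarith
    linarith
  obtain ⟨h, hHh⟩ := isCompact_Icc.exists_bound_of_continuousOn hH.continuousOn
  have hh : 0 ≤ h := (norm_nonneg _).trans (hHh 0 ⟨le_rfl, hT.le⟩)
  -- The estimates want a field continuous on all of ℝ; H is extended by its endpoint values.
  set H' : ℝ → Space d := IccExtend hT.le ((Icc 0 T).domRestrict H) with hH'
  have hH'c : Continuous H' := hH.continuousOn.domRestrict.Icc_extend'
  have hH'eq : ∀ s ∈ Icc 0 T, H' s = H s := fun s hs => IccExtend_of_mem _ _ hs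
  obtain ⟨C, hC, hobs⟩ := exists_observability hd hΩ.isOpen hb hT hja hjj.le hjb hH'c hh
    (fun s hs => (hH'eq s hs).symm ▸ hHh s hs) Metric.diam_nonneg hδ
    -- Here σ = H₀S: the angle condition gives ⟪H(s),η_j⟫ ≥ S|H(s)| ≥ S·H₀.
    (mul_nonneg hH0.le hS0.le) (fun s hs => by
      have hsT : s ∈ Icc 0 T := ⟨hja.trans hs.1, hs.2.trans hjb⟩
      have hHs := minSpeed_le (H := H) hsT
      have hpos : 0 < ‖H s‖ := hH0.trans_le hHs
      have h1 := hangle j hj s hs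
      rw [real_inner_smul_left, inv_mul_eq_div, le_div_iff₀ hpos] at h1
      rw [hH'eq s hsT]
      nlinarith) hgap
  refine ⟨C, hC, fun g u hu htr => hobs g u ?_ htr⟩
  have hQm : MeasurableSet (TransportObs.cylinder Ω T) :=
    hΩ.isOpen.measurableSet.prod measurableSet_Ioo
  filter_upwards [hu, ae_restrict_mem hQm] with z hz hzQ
  rw [hH'eq z.2 (Ioo_subset_Icc_self hzQ.2)]
  exact hz
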